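/- Let $F$ be a field of characteristic different from $2$, let $d\in F^\times$, and let $L=F[X]/(X^2-d)$ be the corresponding quadratic étale $F$-algebra (possibly split), with trace $\mathrm{tr}:L\to F$, norm $N_{L/F}:L\to F$ and nontrivial automorphism $\iota$. All quadratic forms are nondegenerate. For a quadratic form $q$, let $\mathcal C_0(q)$ be its even Clifford algebra and $\gamma$ the canonical involution of $\mathcal C_0(q)$, i.e. the restriction of the involution of the full Clifford algebra that is the identity on vectors. If $q$ has dimension $n$ with $4\mid n$ and $n>0$, and has trivial signed discriminant $d_\pm(q)$, then there is an orthogonal basis $(e_1,\dots,e_n)$ such that some scalar multiple $z$ of $e_1\cdots e_n$ satisfies $z^2=1$; such a $z$ is central in $\mathcal C_0(q)$ and $\gamma$-symmetric, and the components of $\mathcal C_0(q)$ attached to $z$ are $\mathcal C_+(q)=\mathcal C_0(q)\frac{1+z}{2}$ and $\mathcal C_-(q)=\mathcal C_0(q)\frac{1-z}{2}$, with the restrictions $\gamma_\pm$ of $\gamma$. For an $L$-algebra $A$ with an $L$-linear involution $\sigma$, let ${}^\iota A=\{{}^\iota x: x\in A\}$ be the conjugate algebra, in which $c\cdot{}^\iota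 x={}^\iota(\iota(c)x)$ for $c\in L$. The norm $N_{L/F}(A,\sigma)$ is the $F$-algebra of elements of $A\otimes_L{}^\iota A$ fixed under the switch map $x\otimes{}^\iota y\mapsto y\otimes{}^\iota x$, with the restriction of $\sigma\otimes{}^\iota\sigma$. For $c\in F^\times$ let $\langle\!\langle c\rangle\!\rangle=\langle 1,-c\rangle$, and let $\mathrm{Ad}_{\langle\!\langle c\rangle\!\rangle}$ be the algebra $\mathrm{End}_F(F^2)$ with the involution adjoint to the form $\langle\!\langle c\rangle\!\rangle$. Let $\psi$ be a quadratic form on a free $L$-module $V$ of finite rank $\dim(\psi)\equiv 0\bmod 4$, with $d_\pm(\psi)=1$ in $L^\times/L^{\times 2}$, and let $\mathrm{tr}_\star(\psi)$ be its transfer, the quadratic form $v\mapsto\mathrm{tr}(\psi(v))$ on the $F$-vector space $V$. Assume that $\psi$ represents some $\lambda\in L^\times$. Then the even Clifford algebras of $\psi$ and of $\mathrm{tr}_\star(\psi)$ decompose, as algebras with involution over $L$ and over $F$ respectively, as \[(\mathcal C_0(\psi),\gamma)\simeq(\mathcal C_+(\psi),\gamma_+)\times(\mathcal C_-(\psi),\gamma_-)\quad\text{with}\quad(\mathcal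 C_+(\psi),\gamma_+)\simeq(\mathcal C_-(\psi),\gamma_-),\] \[(\mathcal C_0(\mathrm{tr}_\star(\psi)),\gamma)\simeq(\mathcal C_+(\mathrm{tr}_\star(\psi)),\gamma_+)\times(\mathcal C_-(\mathrm{tr}_\star(\psi)),\gamma_-),\] and, for every choice of the elements $z$ that define the components and for every $\lambda\in L^\times$ represented by $\psi$, both components of the even Clifford algebra of $\mathrm{tr}_\star(\psi)$ are given by \[(\mathcal C_\pm(\mathrm{tr}_\star(\psi)),\gamma_\pm)\simeq\mathrm{Ad}_{\langle\!\langle -d\,N_{L/F}(\lambda)\rangle\!\rangle}\otimes_F N_{L/F}(\mathcal C_+(\psi),\gamma_+)\] as $F$-algebras with involution. -/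

import Mathlib

open scoped TensorProduct

noncomputable section

/-! ### Algebras with involution -/

/-- Two `R`-algebras with (`R`-linear) involutions `(A, σ)` and `(B, τ)` are isomorphic: there is an
isomorphism of `R`-algebras which carries `σ` to `τ`. -/
def IsoWithInvolution (R : Type*) {A B : Type*} [CommRing R] [Ring A] [Ring B] [Algebra R A]
    [Algebra R B] (σ : A →ₗ[R] A) (τ : B →ₗ[R] B) : Prop :=
  ∃ f : A ≃ₐ[R] B, ∀ x, f (σ x) = τ (f x)

/-- The involution `σ ⊗ τ` of `A ⊗_R B`. -/
def tensorInvolution {R A B : Type*} [CommRing R] [Ring A] [Ring B] [Algebra R A]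
    [Algebra R B] (σ : A →ₗ[R] A) (τ : B →ₗ[R] B) : A ⊗[R] B →ₗ[R] A ⊗[R] B :=
  TensorProduct.map σ τ

section Adjoint

variable {K V : Type*} [Field K] [AddCommGroup V] [Module K V] [FiniteDimensional K V]

/-- The adjoint involution `ad_B` on `End_K(V)`: `B (ad_B f x) y = B x (f y)`. -/
def adInvolution (B : LinearMap.BilinForm K V) (hB : B.Nondegenerate) :
    Module.End K V →ₗ[K] Module.End K V where
  toFun f := B.leftAdjointOfNondegenerate hB f
  map_add' f g := by
    symm
    rw [← LinearMap.BilinForm.isAdjointPair_iff_eq_of_nondegenerate]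
    exact (B.isAdjointPairLeftAdjointOfNondegenerate hB f).add
      (B.isAdjointPairLeftAdjointOfNondegenerate hB g)
  map_smul' c f := by
    symm
    rw [← LinearMap.BilinForm.isAdjointPair_iff_eq_of_nondegenerate]
    intro x y
    have := B.isAdjointPairLeftAdjointOfNondegenerate hB f x y
    simp [this]

/-- The defining property of the adjoint involution. -/
theorem adInvolution_apply (B : LinearMap.BilinForm K V) (hB : B.Nondegenerate)
    (f : Module.End K V) (x y : V) : B (adInvolution B hB f x) y = B x (f y) :=
  B.isAdjointPairLeftAdjointOfNondegenerate hB f x y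

end Adjoint

section Pfister

variable {K : Type*} [Field K]

/-- The one-fold Pfister form `⟨⟨c⟩⟩ = ⟨1, -c⟩`. -/
def pfister (c : Kˣ) : QuadraticForm K (Fin 2 → K) :=
  QuadraticMap.weightedSumSquares K ![(1 : K), -(c : K)]

theorem pfister_nondegenerate [Invertible (2 : K)] (c : Kˣ) :
    (QuadraticMap.associated (pfister c)).Nondegenerate := by
  have key : ∀ x y : Fin 2 → K,
      QuadraticMap.associated (pfister c) x y = x 0 * y 0 - c * (x 1 * y 1) := by
    intro x y
    have h := congrArg (fun B => B x y)
      (QuadraticMap.two_nsmul_associated K (pfister c))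
    simp only [LinearMap.smul_apply, QuadraticMap.polarBilin_apply_apply,
      QuadraticMap.polar, pfister, QuadraticMap.weightedSumSquares_apply, Fin.sum_univ_two,
      Pi.add_apply, Matrix.cons_val_zero, Matrix.cons_val_one, smul_eq_mul, nsmul_eq_mul,
      Nat.cast_ofNat] at h
    have h2 : (2 : K) ≠ 0 := Invertible.ne_zero 2
    apply mul_left_cancel₀ h2
    refine Eq.trans h ?_
    ring
  have hc : (c : K) ≠ 0 := c.ne_zero
  refine ⟨fun x hx => ?_, fun x hx => ?_⟩
  · have h0 := hx ![1, 0]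
    have h1 := hx ![0, 1]
    rw [key] at h0 h1
    ext i
    fin_cases i <;> simp_all
  · have h0 := hx ![1, 0]
    have h1 := hx ![0, 1]
    rw [key] at h0 h1
    ext i
    fin_cases i <;> simp_all

/-- The involution of `Ad_⟨⟨c⟩⟩ = (End_K(K²), ad_⟨⟨c⟩⟩)`. -/
def adPfister [Invertible (2 : K)] (c : Kˣ) :
    Module.End K (Fin 2 → K) →ₗ[K] Module.End K (Fin 2 → K) :=
  adInvolution (QuadraticMap.associated (pfister c)) (pfister_nondegenerate c)

end Pfister

/-! ### The algebra `e A e` of an idempotent `e` -/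

section Corner

variable {A : Type*} [Ring A] {e : A} (he : IsIdempotentElem e)

instance cornerModule (S : Type*) [CommSemiring S] [Algebra S A] : Module S he.Corner :=
  { smul := fun s x => ⟨s • x.1, by
      obtain ⟨a, ha⟩ := x.2
      exact ⟨s • a, by simp only [← ha, mul_smul_comm, smul_mul_assoc]⟩⟩
    one_smul := fun _ => Subtype.ext (one_smul _ _)
    mul_smul := fun _ _ _ => Subtype.ext (mul_smul _ _ _)
    smul_zero := fun _ => Subtype.ext (smul_zero _)
    smul_add := fun _ _ _ => Subtype.ext (smul_add _ _ _)
    add_smul := fun _ _ _ => Subtype.ext (add_smul _ _ _)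
    zero_smul := fun _ => Subtype.ext (zero_smul _ _) }

instance cornerAlgebra (S : Type*) [CommSemiring S] [Algebra S A] : Algebra S he.Corner :=
  Algebra.ofModule (fun _ _ _ => Subtype.ext (smul_mul_assoc _ _ _))
    (fun _ _ _ => Subtype.ext (mul_smul_comm _ _ _))

instance cornerIsScalarTower (S T : Type*) [CommSemiring S] [CommSemiring T] [Algebra S T]
    [Algebra S A] [Algebra T A] [IsScalarTower S T A] : IsScalarTower S T he.Corner :=
  ⟨fun _ _ _ => Subtype.ext (smul_assoc _ _ _)⟩

end Corner

/-! ### The even Clifford algebra and its components -/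

section Clifford

variable {R M : Type*} [CommRing R] [AddCommGroup M] [Module R M]

/-- `(-1)^{n(n-1)/2} det(b) = 1` in `R / R^{×2}`, where `n` is the rank of the quadratic form and
`det(b)` is the determinant of its Gram matrix in some basis. -/
def HasTrivialDiscriminant [Invertible (2 : R)] (Q : QuadraticForm R M) : Prop :=
  ∃ (b : Module.Basis (Fin (Module.finrank R M)) R M) (u : Rˣ),
    (-1) ^ (Module.finrank R M * (Module.finrank R M - 1) / 2) *
      (LinearMap.BilinForm.toMatrix b (QuadraticMap.associated Q)).det = (u : R) ^ 2

/-- The canonical involution `γ` of the even Clifford algebra `C₀(Q)`; it is the restriction of the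
involution of the full Clifford algebra which is the identity on vectors. -/
def evenInvolution (Q : QuadraticForm R M) :
    CliffordAlgebra.even Q →ₗ[R] CliffordAlgebra.even Q :=
  (CliffordAlgebra.reverse (Q := Q)).restrict (p := Subalgebra.toSubmodule (CliffordAlgebra.even Q))
    (q := Subalgebra.toSubmodule (CliffordAlgebra.even Q))
    (fun _ hx => (CliffordAlgebra.reverse_mem_evenOdd_iff (Q := Q) (n := 0)).mpr hx)

@[simp]
theorem coe_evenInvolution (Q : QuadraticForm R M) (x : CliffordAlgebra.even Q) :
    (evenInvolution Q x : CliffordAlgebra Q) = CliffordAlgebra.reverse (x : CliffordAlgebra Q) :=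
  rfl

theorem evenInvolution_mul (Q : QuadraticForm R M) (x y : CliffordAlgebra.even Q) :
    evenInvolution Q (x * y) = evenInvolution Q y * evenInvolution Q x :=
  Subtype.ext (CliffordAlgebra.reverse.map_mul _ _)

theorem evenInvolution_one (Q : QuadraticForm R M) : evenInvolution Q 1 = 1 :=
  Subtype.ext CliffordAlgebra.reverse.map_one

/-- For a quadratic form `Q` of rank `n` divisible by `4`, an element `z` of `C₀(Q)` with `z² = 1`
which is a scalar multiple of `e₁ ⋯ eₙ` for some orthogonal basis `(e₁, …, eₙ)`.
Such a `z` is central in `C₀(Q)`, and the two components of `C₀(Q)` are `C₀(Q) (1 + z)/2` and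
`C₀(Q) (1 - z)/2`. -/
structure CliffordOrientation (Q : QuadraticForm R M) where
  /-- the element -/
  z : CliffordAlgebra.even Q
  four_dvd : 4 ∣ Module.finrank R M
  sq_eq_one : z * z = 1
  exists_basis : ∃ (b : Module.Basis (Fin (Module.finrank R M)) R M) (c : R),
    (∀ i j, i ≠ j → QuadraticMap.polar Q (b i) (b j) = 0) ∧
    (z : CliffordAlgebra Q) = c • (List.ofFn fun i => CliffordAlgebra.ι Q (b i)).prod

theorem ι_mul_prod_of_orthogonal (Q : QuadraticForm R M) (a : M) (l : List M)
    (h : ∀ b ∈ l, QuadraticMap.polar Q a b = 0) :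
    (l.map (CliffordAlgebra.ι Q)).prod * CliffordAlgebra.ι Q a =
      (-1 : R) ^ l.length • (CliffordAlgebra.ι Q a * (l.map (CliffordAlgebra.ι Q)).prod) := by
  induction l with
  | nil => simp
  | cons b l ih =>
    have hb : CliffordAlgebra.ι Q b * CliffordAlgebra.ι Q a =
        -(CliffordAlgebra.ι Q a * CliffordAlgebra.ι Q b) := by
      have := CliffordAlgebra.ι_mul_ι_add_swap (Q := Q) a b
      rw [h b (by simp), map_zero] at this
      exact eq_neg_of_add_eq_zero_right this
    have ih' := ih (fun c hc => h c (by simp [hc]))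
    simp only [List.map_cons, List.prod_cons, List.length_cons]
    rw [mul_assoc, ih', mul_smul_comm, ← mul_assoc, hb, pow_succ, mul_smul]
    simp [mul_assoc]

theorem reverse_prod_of_orthogonal (Q : QuadraticForm R M) (l : List M)
    (h : l.Pairwise fun a b => QuadraticMap.polar Q a b = 0) :
    CliffordAlgebra.reverse (l.map (CliffordAlgebra.ι Q)).prod =
      (-1 : R) ^ (l.length.choose 2) • (l.map (CliffordAlgebra.ι Q)).prod := by
  induction l with
  | nil => simp [CliffordAlgebra.reverse.map_one]
  | cons a l ih =>
    rw [List.pairwise_cons] at h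
    simp only [List.map_cons, List.prod_cons, List.length_cons]
    rw [CliffordAlgebra.reverse.map_mul, ih h.2, CliffordAlgebra.reverse_ι, smul_mul_assoc,
      ι_mul_prod_of_orthogonal Q a l h.1, smul_smul, ← pow_add, Nat.choose_succ_succ' l.length 1,
      Nat.choose_one_right, add_comm]

namespace CliffordOrientation

variable {Q : QuadraticForm R M} (o : CliffordOrientation Q)

/-- The element `z` is `γ`-symmetric. -/
theorem evenInvolution_z : evenInvolution Q o.z = o.z := by
  obtain ⟨b, c, hb, hz⟩ := o.exists_basis
  apply Subtype.ext
  have hl : (List.ofFn fun i => CliffordAlgebra.ι Q (b i)) =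
      (List.ofFn b).map (CliffordAlgebra.ι Q) := by
    rw [List.map_ofFn]; rfl
  have hp : (List.ofFn b).Pairwise fun x y => QuadraticMap.polar Q x y = 0 := by
    rw [List.pairwise_ofFn]
    exact fun i j hij => hb i j hij.ne
  have he : Even ((Module.finrank R M).choose 2) := by
    obtain ⟨k, hk⟩ := o.four_dvd
    rw [hk, Nat.choose_two_right]
    refine ⟨k * (4 * k - 1), ?_⟩
    have : 4 * k * (4 * k - 1) = 2 * (k * (4 * k - 1) + k * (4 * k - 1)) := by ring
    rw [this, Nat.mul_div_cancel_left _ (by norm_num)]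
  rw [coe_evenInvolution, hz, hl, map_smul, reverse_prod_of_orthogonal Q _ hp, List.length_ofFn,
    he.neg_one_pow, one_smul]

/-- The orientation `-z`; it exchanges the two components. -/
def neg : CliffordOrientation Q where
  z := -o.z
  four_dvd := o.four_dvd
  sq_eq_one := by rw [neg_mul_neg, o.sq_eq_one]
  exists_basis := by
    obtain ⟨b, c, hb, hz⟩ := o.exists_basis
    exact ⟨b, -c, hb, by rw [neg_smul, ← hz]; rfl⟩

variable [Invertible (2 : R)]

/-- The idempotent `(1 + z)/2`. -/
def idem : CliffordAlgebra.even Q := (⅟2 : R) • (1 + o.z)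

theorem isIdempotentElem_idem : IsIdempotentElem o.idem := by
  have h : (1 + o.z) * (1 + o.z) = (2 : R) • (1 + o.z) := by
    rw [mul_add, add_mul, add_mul, o.sq_eq_one, two_smul]
    simp only [one_mul, mul_one]
    abel
  unfold IsIdempotentElem idem
  rw [smul_mul_smul_comm, h, smul_smul, mul_assoc, invOf_mul_self, mul_one]

theorem evenInvolution_idem : evenInvolution Q o.idem = o.idem := by
  rw [idem, map_smul, map_add, evenInvolution_one, o.evenInvolution_z]

/-- The component `C₊(Q) = C₀(Q) e` of the even Clifford algebra, with unit `e = (1 + z)/2`. As `e`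
is central in `C₀(Q)`, it is the same as `e C₀(Q) e`. The other component is `o.neg.Component`. -/
abbrev Component : Type _ := o.isIdempotentElem_idem.Corner

/-- The involution `γ₊` which `γ` induces on the component, that is, the restriction of `γ`. -/
def componentInvolution : o.Component →ₗ[R] o.Component where
  toFun x := ⟨evenInvolution Q x.1, by
    obtain ⟨a, ha⟩ := x.2
    refine ⟨evenInvolution Q a, ?_⟩
    simp only [← ha, evenInvolution_mul, o.evenInvolution_idem, mul_assoc]⟩
  map_add' _ _ := Subtype.ext (map_add (evenInvolution Q) _ _)
  map_smul' _ _ := Subtype.ext (map_smul (evenInvolution Q) _ _)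

end CliffordOrientation

end Clifford

/-! ### The norm (corestriction) of an algebra with involution -/

section Norm

variable {F L : Type*} [CommRing F] [CommRing L] [Algebra F L]

/-- The conjugate `L`-algebra `{}^ι A` of an `L`-algebra `A`: the same ring, on which `c ∈ L` acts as
`ι c` acts on `A`. -/
def ConjugateAlgebra (_ι : L →ₐ[F] L) (A : Type*) : Type _ := A

variable (ι : L →ₐ[F] L) (A : Type*) [Ring A] [Algebra L A]

instance : Ring (ConjugateAlgebra ι A) := inferInstanceAs (Ring A)

/-- The map `x ↦ {}^ι x`. -/
def toConjugate : A ≃+* ConjugateAlgebra ι A := RingEquiv.refl A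

instance : Algebra L (ConjugateAlgebra ι A) where
  smul c x := toConjugate ι A (ι c • (toConjugate ι A).symm x)
  algebraMap := ((toConjugate ι A : A →+* ConjugateAlgebra ι A).comp (algebraMap L A)).comp
    (ι : L →+* L)
  commutes' c x := (toConjugate ι A).symm.injective (by
    simp [Algebra.commutes])
  smul_def' c x := (toConjugate ι A).symm.injective (by
    change ι c • (toConjugate ι A).symm x = _
    simp [Algebra.smul_def])

variable {A}

theorem smul_toConjugate (c : L) (x : A) : c • toConjugate ι A x = toConjugate ι A (ι c • x) :=
  rfl

theorem toConjugate_smul (hι : ∀ c, ι (ι c) = c) (c : L) (x : A) :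
    toConjugate ι A (c • x) = ι c • toConjugate ι A x := by
  rw [smul_toConjugate, hι]

variable (A)

/-- The switch map `x ⊗ {}^ι y ↦ y ⊗ {}^ι x` of `A ⊗_L {}^ι A`, where `ι² = 1`. -/
def switch (hι : ∀ c, ι (ι c) = c) :
    A ⊗[L] ConjugateAlgebra ι A →+ A ⊗[L] ConjugateAlgebra ι A :=
  TensorProduct.liftAddHom
    (AddMonoidHom.mk' (fun x => AddMonoidHom.mk'
      (fun y => ((toConjugate ι A).symm y) ⊗ₜ[L] (toConjugate ι A x))
      (fun y y' => by rw [map_add, TensorProduct.add_tmul]))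
      (fun x x' => by ext y; simp [TensorProduct.tmul_add]))
    (fun c x y => by
      obtain ⟨y, rfl⟩ := (toConjugate ι A).surjective y
      simp only [AddMonoidHom.mk'_apply]
      rw [smul_toConjugate, toConjugate_smul ι hι, RingEquiv.symm_apply_apply,
        RingEquiv.symm_apply_apply, TensorProduct.smul_tmul])

@[simp]
theorem switch_tmul (hι : ∀ c, ι (ι c) = c) (x y : A) :
    switch ι A hι (x ⊗ₜ[L] toConjugate ι A y) = y ⊗ₜ[L] toConjugate ι A x :=
  rfl

theorem switch_mul (hι : ∀ c, ι (ι c) = c) (u v : A ⊗[L] ConjugateAlgebra ι A) :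
    switch ι A hι (u * v) = switch ι A hι u * switch ι A hι v := by
  induction u with
  | zero => simp
  | add u u' hu hu' => simp only [add_mul, map_add, hu, hu']
  | tmul x y =>
    induction v with
    | zero => simp
    | add v v' hv hv' => simp only [mul_add, map_add, hv, hv']
    | tmul x' y' =>
      obtain ⟨y, rfl⟩ := (toConjugate ι A).surjective y
      obtain ⟨y', rfl⟩ := (toConjugate ι A).surjective y'
      rw [Algebra.TensorProduct.tmul_mul_tmul, ← map_mul]
      rw [switch_tmul, switch_tmul, switch_tmul, Algebra.TensorProduct.tmul_mul_tmul, ← map_mul]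

variable {A}

/-- The conjugate `{}^ι x ↦ {}^ι (σ x)` of an `L`-linear map `σ`. -/
def conjugateMap (σ : A →ₗ[L] A) : ConjugateAlgebra ι A →ₗ[L] ConjugateAlgebra ι A where
  toFun x := toConjugate ι A (σ ((toConjugate ι A).symm x))
  map_add' x y := by simp
  map_smul' c x := by
    obtain ⟨x, rfl⟩ := (toConjugate ι A).surjective x
    rw [smul_toConjugate]
    simp [smul_toConjugate]

theorem switch_map (hι : ∀ c, ι (ι c) = c) (σ : A →ₗ[L] A) (u : A ⊗[L] ConjugateAlgebra ι A) :
    switch ι A hι (TensorProduct.map σ (conjugateMap ι σ) u) =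
      TensorProduct.map σ (conjugateMap ι σ) (switch ι A hι u) := by
  induction u with
  | zero => simp
  | add u v hu hv => simp only [map_add, hu, hv]
  | tmul x y => rfl

variable (A)
variable [Algebra F A] [IsScalarTower F L A]

/-- The norm `N_{L/F}(A)`: the `F`-algebra of elements of `A ⊗_L {}^ι A` fixed by the switch map. -/
def normAlgebra (hι : ∀ c, ι (ι c) = c) : Subalgebra F (A ⊗[L] ConjugateAlgebra ι A) where
  carrier := {u | switch ι A hι u = u}
  mul_mem' {u v} hu hv := by
    change switch ι A hι (u * v) = u * v
    change switch ι A hι u = u at hu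
    change switch ι A hι v = v at hv
    rw [switch_mul, hu, hv]
  add_mem' {u v} hu hv := by
    change switch ι A hι (u + v) = u + v
    change switch ι A hι u = u at hu
    change switch ι A hι v = v at hv
    rw [map_add, hu, hv]
  algebraMap_mem' c := by
    have h1 : algebraMap F (A ⊗[L] ConjugateAlgebra ι A) c =
        (algebraMap L A (algebraMap F L c)) ⊗ₜ[L] toConjugate ι A 1 := by
      rw [← IsScalarTower.algebraMap_apply, map_one]
      rfl
    have h2 : toConjugate ι A (algebraMap L A (algebraMap F L c)) =
        algebraMap F L c • toConjugate ι A 1 := by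
      rw [smul_toConjugate, ι.commutes, Algebra.algebraMap_eq_smul_one]
    change switch ι A hι (algebraMap F _ c) = algebraMap F _ c
    rw [h1, switch_tmul, h2, TensorProduct.tmul_smul, TensorProduct.smul_tmul',
      ← Algebra.algebraMap_eq_smul_one]

variable {A}

/-- The involution `N_{L/F}(σ)` of `N_{L/F}(A)`: the restriction of `σ ⊗ {}^ι σ`. -/
def normInvolution (hι : ∀ c, ι (ι c) = c) (σ : A →ₗ[L] A) :
    normAlgebra ι A hι →ₗ[F] normAlgebra ι A hι :=
  ((TensorProduct.map σ (conjugateMap ι σ)).restrictScalars F).restrict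
    (p := Subalgebra.toSubmodule (normAlgebra ι A hι))
    (q := Subalgebra.toSubmodule (normAlgebra ι A hι))
    (fun u hu => by
      change switch ι A hι (TensorProduct.map σ (conjugateMap ι σ) u) = _
      rw [switch_map]
      exact congrArg _ hu)

end Norm

/-! ### Quadratic étale algebras and the transfer -/

section Etale

open Polynomial

variable {F : Type*} [Field F]

/-- The quadratic étale algebra `F[X]/(X² - d)`, for `d ∈ Fˣ` and `F` of characteristic not `2`. -/
abbrev QuadraticEtale (d : Fˣ) : Type _ := AdjoinRoot (X ^ 2 - C (d : F))

/-- The nontrivial automorphism of `F[X]/(X² - d)`, which maps the class of `X` to its negative. -/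
def etaleConj (d : Fˣ) : QuadraticEtale d →ₐ[F] QuadraticEtale d :=
  AdjoinRoot.liftAlgHom (X ^ 2 - C (d : F)) (Algebra.ofId F (QuadraticEtale d))
    (-AdjoinRoot.root (X ^ 2 - C (d : F))) (by
      have h := AdjoinRoot.eval₂_root (X ^ 2 - C (d : F))
      simp only [eval₂_sub, eval₂_X_pow, eval₂_C] at h
      simp only [eval₂_sub, eval₂_X_pow, eval₂_C, neg_sq]
      exact h)

theorem etaleConj_etaleConj (d : Fˣ) (x : QuadraticEtale d) : etaleConj d (etaleConj d x) = x := by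
  have h : (etaleConj d).comp (etaleConj d) = AlgHom.id F _ := by
    apply AdjoinRoot.algHom_ext
    simp [etaleConj]
  exact DFunLike.congr_fun h x

instance [Invertible (2 : F)] (d : Fˣ) : Invertible (2 : QuadraticEtale d) :=
  (Invertible.map (algebraMap F (QuadraticEtale d)) (2 : F)).copy _ (map_ofNat _ 2).symm

/-- The transfer `tr_⋆(ψ) : v ↦ tr_{L/F}(ψ(v))`, a quadratic form over `F` on the `F`-vector space
underlying the `L`-module of `ψ`. -/
def transfer {d : Fˣ} {V : Type*} [AddCommGroup V] [Module (QuadraticEtale d) V] [Module F V]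
    [IsScalarTower F (QuadraticEtale d) V] (ψ : QuadraticForm (QuadraticEtale d) V) :
    QuadraticForm F V :=
  (Algebra.trace F (QuadraticEtale d)).compQuadraticMap' ψ

end Etale

end

/-! Fix `v₀` with ψ(v₀) = λ, and let e = (1 + z)/2, B = C₊(ψ), σ = γ₊. The map x(w) = e·w·v₀ from V
to B is a similitude: x(v)σ(x(v)) and σ(x(v))x(v) both equal λψ(v). Let T = B ⊗ ᶥB and let δ be the
class of X, so δ² = d and ι(δ) = -δ. From x(v), σ(x(v)) and their conjugates one builds matrices
R(v), C(v) over T (`rowMap`, `colMap`) with R(v)C(v) = C(v)R(v) = ψ(v) + ι(ψ(v)), which is the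
transfer of ψ at v. Hence vw ↦ R(v)C(w) defines a homomorphism f from C₀(tr⋆ψ) to M₂(T)
(`evenLift`).

The entries of R(v)C(w) are fixed by the switch, so f lands in M₂(N), where N is the norm of B
(`evenLift_mem_normAlgebra`). Reversal becomes the involution adjoint to diag(1, δ²λι(λ))
(`evenLift_evenInvolution`); since δ²λι(λ) = d·N(λ), this is where the Pfister form ⟨1, d·N(λ)⟩
comes from.

Surjectivity onto M₂(N): replacing v and w by δv and δw separates the summands of R(v)C(w), and
these generate M₂(T) over L (`rangeAdjoin_eq_top`); then L = F + Fδ allows descent to the elements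
fixed by the switch (`evenLift_surjective`).

Injectivity on a component is proved without counting dimensions. Averaging over conjugations by
products of two orthogonal basis vectors projects C₀ onto the span of 1 and z, and detects nonzero
elements (`exists_conjAverage`). The same averages show that the centre of T is scalar, whence f(z)
= ±1 (`evenLift_z`), and that the kernel of f dies in the component selected by that sign
(`idem_mul_eq_zero`). Conjugation by a vector with invertible value exchanges the two components, so
both have the same description.

Orientations exist because L is a product of fields, over which ψ can be diagonalised, and because
the transfer of a form ⟨a⟩ has an explicit orthogonal basis. -/

noncomputable section

/-! ### Words in an anticommuting family -/

section Words

variable {R A I : Type*} [CommRing R] [Ring A] [Algebra R A] {g : I → A}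

/-- Each letter other than `i` contributes a sign. The exponent should be the length minus the
number of occurrences of `i`; the sum has the same parity. -/
theorem mul_prod_map_of_anticommute [DecidableEq I]
    (hg : ∀ i j, i ≠ j → g i * g j = -(g j * g i)) (i : I)
    (l : List I) :
    g i * (l.map g).prod = (-1 : R) ^ (l.length + l.count i) • ((l.map g).prod * g i) := by
  induction l with
  | nil => simp
  | cons j l ih =>
    simp only [List.map_cons, List.prod_cons, List.length_cons]
    rcases eq_or_ne i j with rfl | h
    · rw [List.count_cons_self, mul_assoc, ih, mul_smul_comm,
        show l.length + 1 + (l.count i + 1) = l.length + l.count i + 2 by ring,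
        pow_add (-1 : R) _ 2, neg_one_sq, mul_one]
    · rw [List.count_cons_of_ne h.symm, ← mul_assoc, hg i j h, neg_mul, mul_assoc, ih,
        mul_smul_comm, ← mul_assoc,
        show l.length + 1 + l.count i = l.length + l.count i + 1 by ring, pow_succ]
      simp

theorem mul_mul_prod_map_of_anticommute [DecidableEq I]
    (hg : ∀ i j, i ≠ j → g i * g j = -(g j * g i)) (i j : I)
    (l : List I) :
    g i * g j * (l.map g).prod =
      (-1 : R) ^ (l.count i + l.count j) • ((l.map g).prod * (g i * g j)) := by
  rw [mul_assoc, mul_prod_map_of_anticommute (R := R) hg j, mul_smul_comm, ← mul_assoc,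
    mul_prod_map_of_anticommute (R := R) hg i, smul_mul_assoc, smul_smul, ← pow_add, mul_assoc,
    show l.length + l.count j + (l.length + l.count i) =
      2 * l.length + (l.count i + l.count j) by ring, pow_add, pow_mul]
  simp

theorem prod_map_perm_of_anticommute (hg : ∀ i j, i ≠ j → g i * g j = -(g j * g i))
    {l l' : List I} (h : l.Perm l') :
    (l.map g).prod = (l'.map g).prod ∨ (l.map g).prod = -(l'.map g).prod := by
  induction h with
  | nil => exact Or.inl rfl
  | cons x _ ih =>
    rcases ih with h | h
    · left; simp [h]
    · right; simp [h]
  | swap x y l =>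
    rcases eq_or_ne x y with rfl | h
    · exact Or.inl rfl
    · right
      simp only [List.map_cons, List.prod_cons]
      rw [← mul_assoc, hg y x h.symm, neg_mul, mul_assoc]
  | trans _ _ ih₁ ih₂ =>
    rcases ih₁ with h₁ | h₁ <;> rcases ih₂ with h₂ | h₂ <;> simp [h₁, h₂]

variable {q : I → R}

theorem prod_map_mul_prod_map_reverse (hq : ∀ i, g i * g i = algebraMap R A (q i))
    (l : List I) :
    (l.map g).prod * (l.reverse.map g).prod = algebraMap R A (l.map q).prod := by
  induction l with
  | nil => simp
  | cons a l ih =>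
    simp only [List.reverse_cons, List.map_append, List.map_cons, List.map_nil, List.prod_append,
      List.prod_cons, List.prod_nil, mul_one]
    calc g a * (l.map g).prod * ((l.reverse.map g).prod * g a)
        = g a * ((l.map g).prod * (l.reverse.map g).prod) * g a := by simp only [mul_assoc]
      _ = _ := by
        rw [ih, ← Algebra.commutes, mul_assoc, hq, ← map_mul, mul_comm]

/-- Bringing two equal letters together costs only a sign, and the pair is then the scalar `q a`;
the shorter word still has even counts. -/
theorem exists_prod_map_eq_algebraMap [DecidableEq I]
    (hg : ∀ i j, i ≠ j → g i * g j = -(g j * g i))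
    (hq : ∀ i, g i * g i = algebraMap R A (q i)) (l : List I) (hl : ∀ i, Even (l.count i)) :
    ∃ r : R, (l.map g).prod = algebraMap R A r := by
  induction h : l.length using Nat.strong_induction_on generalizing l with
  | _ n ih =>
    cases l with
    | nil => exact ⟨1, by simp⟩
    | cons a l =>
      have ha : a ∈ l := by
        have := hl a
        rw [List.count_cons_self] at this
        by_contra hn
        rw [List.count_eq_zero_of_not_mem hn] at this
        simp at this
      have hp : (a :: l).Perm (a :: a :: l.erase a) := (List.perm_cons_erase ha).cons a
      obtain ⟨r, hr⟩ := ih (l.erase a).length (by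
          rw [List.length_erase_of_mem ha, ← h, List.length_cons]
          omega) (l.erase a) (fun i => by
          have h1 := hl i
          rw [hp.count_eq i, List.count_cons, List.count_cons] at h1
          split_ifs at h1
          · rw [add_assoc, Nat.even_add] at h1
            exact h1.mpr (by decide)
          · simpa using h1) rfl
      have e : ((a :: a :: l.erase a).map g).prod = algebraMap R A (q a * r) := by
        simp only [List.map_cons, List.prod_cons]
        rw [← mul_assoc, hq, hr, map_mul]
      rcases prod_map_perm_of_anticommute hg hp with h' | h'
      · exact ⟨_, h'.trans e⟩
      · exact ⟨-(q a * r), by rw [h', e, map_neg]⟩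

end Words

/-! ### Averages over conjugations -/

section Average

variable (R : Type*) {A B : Type*} [CommRing R] [Invertible (2 : R)] [Ring A] [Algebra R A]
  [Ring B] [Algebra R B]

/-- The composition of the maps `x ↦ (x + u x u⁻¹) / 2`, for `u` in a list of units. -/
def conjAverage : List Aˣ → A →ₗ[R] A
  | [] => LinearMap.id
  | u :: us => (⅟2 : R) • (LinearMap.id + (LinearMap.mulLeft R (u : A)) ∘ₗ
      (LinearMap.mulRight R ((u⁻¹ : Aˣ) : A))) ∘ₗ conjAverage us

@[simp]
theorem conjAverage_nil (x : A) : conjAverage R [] x = x := rfl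

theorem conjAverage_cons (u : Aˣ) (us : List Aˣ) (x : A) :
    conjAverage R (u :: us) x = (⅟2 : R) •
      (conjAverage R us x + u * conjAverage R us x * (u⁻¹ : Aˣ)) := by
  simp [conjAverage, mul_assoc]

theorem invOf_two_smul_add_self {M : Type*} [AddCommGroup M] [Module R M] (x : M) :
    (⅟2 : R) • (x + x) = x := by
  rw [← two_smul R x, smul_smul, invOf_mul_self, one_smul]

theorem eq_zero_of_invOf_two_smul {M : Type*} [AddCommGroup M] [Module R M] {x : M}
    (h : (⅟2 : R) • x = 0) : x = 0 := by
  rw [← one_smul R x, ← mul_invOf_self (2 : R), mul_smul, h, smul_zero]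

theorem eq_zero_of_add_self {M : Type*} [AddCommGroup M] [Module R M] {x : M} (h : x + x = 0) :
    x = 0 := by
  rw [← invOf_two_smul_add_self R x, h, smul_zero]

theorem eq_zero_of_eq_neg {M : Type*} [AddCommGroup M] [Module R M] {x : M} (h : x = -x) :
    x = 0 := by
  apply eq_zero_of_add_self R
  nth_rewrite 2 [h]
  exact add_neg_cancel x

theorem conjAverage_of_commute {us : List Aˣ} {x : A} (h : ∀ u ∈ us, Commute (u : A) x) :
    conjAverage R us x = x := by
  induction us with
  | nil => rfl
  | cons u us ih =>
    rw [conjAverage_cons, ih fun v hv => h v (by simp [hv]), (h u (by simp)).eq, mul_assoc,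
      Units.mul_inv, mul_one, invOf_two_smul_add_self]

theorem conjAverage_mul_of_commute {us : List Aˣ} {y : A} (h : ∀ u ∈ us, Commute (u : A) y)
    (x : A) : conjAverage R us (x * y) = conjAverage R us x * y := by
  induction us with
  | nil => rfl
  | cons u us ih =>
    have hy : y * ((u⁻¹ : Aˣ) : A) = (u⁻¹ : Aˣ) * y :=
      (((h u (by simp)).symm).units_inv_right).eq
    rw [conjAverage_cons, conjAverage_cons, ih fun v hv => h v (by simp [hv]), smul_mul_assoc,
      add_mul]
    simp only [mul_assoc, hy]

theorem map_conjAverage (f : A →ₐ[R] B) (us : List Aˣ) (x : A) :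
    f (conjAverage R us x) = conjAverage R (us.map (Units.map (f : A →* B))) (f x) := by
  induction us with
  | nil => rfl
  | cons u us ih =>
    rw [List.map_cons, conjAverage_cons, conjAverage_cons, map_smul, map_add, map_mul, map_mul, ih]
    rfl

/-- The units can be removed one at a time. If `t` is the average over the remaining ones, testing
against `w` gives t + utu⁻¹ = 0. Testing against `w * y j` gives t - utu⁻¹ = 0, since `y j`
anticommutes with `u j` and passes through the other averages. As 2 is invertible, t = 0. -/
theorem eq_zero_of_conjAverage_mul_eq_zero {I : Type*} (u y : I → Aˣ) (js : List I)
    (hjs : js.Nodup) (h₁ : ∀ i ∈ js, (u i : A) * y i = -(y i * u i))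
    (h₂ : ∀ i ∈ js, ∀ j ∈ js, i ≠ j → Commute (u i : A) (y j))
    {x : A} (hx : ∀ w, conjAverage R (js.map u) (x * w) = 0) : x = 0 := by
  induction js with
  | nil => simpa using hx 1
  | cons j js ih =>
    rw [List.nodup_cons] at hjs
    refine ih hjs.2 (fun i hi => h₁ i (by simp [hi])) (fun i hi k hk => h₂ i (by simp [hi]) k (by simp [hk])) fun w => ?_
    have hc : ∀ v ∈ js.map u, Commute (v : A) (y j) := by
      intro v hv
      obtain ⟨i, hi, rfl⟩ := List.mem_map.mp hv
      exact h₂ i (by simp [hi]) j (by simp) (fun e => hjs.1 (e ▸ hi))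
    set t := conjAverage R (js.map u) (x * w)
    have e₁ : t + u j * t * ((u j)⁻¹ : Aˣ) = 0 := by
      have := hx w
      rw [List.map_cons, conjAverage_cons] at this
      exact eq_zero_of_invOf_two_smul R this
    have e₂ : t * y j + u j * (t * y j) * ((u j)⁻¹ : Aˣ) = 0 := by
      have := hx (w * y j)
      rw [List.map_cons, conjAverage_cons, ← mul_assoc, conjAverage_mul_of_commute R hc] at this
      exact eq_zero_of_invOf_two_smul R this
    have e₃ : (y j : A) * ((u j)⁻¹ : Aˣ) = -(((u j)⁻¹ : Aˣ) * y j) := by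
      rw [Units.mul_inv_eq_iff_eq_mul, neg_mul, mul_assoc, ← mul_neg, ← h₁ j (by simp),
        Units.inv_mul_cancel_left]
    have e₄ : t - u j * t * ((u j)⁻¹ : Aˣ) = 0 := by
      rw [← (y j).mul_left_inj, zero_mul, ← e₂, sub_mul]
      simp only [mul_assoc, e₃, mul_neg, sub_eq_add_neg]
    apply eq_zero_of_add_self R
    calc t + t = (t + u j * t * ((u j)⁻¹ : Aˣ)) + (t - u j * t * ((u j)⁻¹ : Aˣ)) := by abel
      _ = 0 := by rw [e₁, e₄, add_zero]

end Average

/-! ### Orientations of Clifford algebras -/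

section Orientation

variable {R M : Type*} [CommRing R] [AddCommGroup M] [Module R M]

/-- The scalar part of an element of a Clifford algebra, a retraction of `R → C(Q)`. -/
def cliffordScalarPart [Invertible (2 : R)] (Q : QuadraticForm R M) : CliffordAlgebra Q →ₗ[R] R :=
  (ExteriorAlgebra.algebraMapInv (R := R) (M := M)).toLinearMap ∘ₗ
    (CliffordAlgebra.equivExterior Q).toLinearMap

theorem cliffordScalarPart_algebraMap [Invertible (2 : R)] (Q : QuadraticForm R M) (r : R) :
    cliffordScalarPart Q (algebraMap R _ r) = r := by
  have h : CliffordAlgebra.equivExterior Q (algebraMap R _ r) = algebraMap R _ r :=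
    CliffordAlgebra.changeForm_algebraMap CliffordAlgebra.changeForm.associated_neg_proof r
  rw [cliffordScalarPart, LinearMap.comp_apply, LinearEquiv.coe_coe, h]
  exact ExteriorAlgebra.algebraMap_leftInverse M r

variable {Q : QuadraticForm R M}

theorem ι_mul_ι_of_polar_eq_zero {v w : M} (h : QuadraticMap.polar Q v w = 0) :
    CliffordAlgebra.ι Q v * CliffordAlgebra.ι Q w =
      -(CliffordAlgebra.ι Q w * CliffordAlgebra.ι Q v) := by
  have := CliffordAlgebra.ι_mul_ι_add_swap (Q := Q) v w
  rw [h, map_zero] at this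
  exact eq_neg_of_add_eq_zero_left this

/-- Even products of an orthogonal basis span the even Clifford algebra. -/
theorem even_le_span_prod {I : Type*} [Fintype I] (b : Module.Basis I R M) :
    Subalgebra.toSubmodule (CliffordAlgebra.even Q) ≤ Submodule.span R
      {x | ∃ l : List I, Even l.length ∧ x = (l.map fun i => CliffordAlgebra.ι Q (b i)).prod} := by
  intro x hx
  induction x, hx using CliffordAlgebra.even_induction with
  | algebraMap r =>
    rw [Algebra.algebraMap_eq_smul_one]
    exact Submodule.smul_mem _ _ (Submodule.subset_span ⟨[], by simp, by simp⟩)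
  | add x y _ _ hx hy => exact Submodule.add_mem _ hx hy
  | ι_mul_ι_mul m₁ m₂ x _ hx =>
    rw [← b.sum_repr m₁, ← b.sum_repr m₂, map_sum, map_sum, Finset.sum_mul, Finset.sum_mul]
    refine Submodule.sum_mem _ fun i _ => ?_
    rw [Finset.mul_sum, Finset.sum_mul]
    refine Submodule.sum_mem _ fun j _ => ?_
    rw [map_smul, map_smul, smul_mul_smul_comm, smul_mul_assoc]
    refine Submodule.smul_mem _ _ ?_
    clear * - hx
    induction hx using Submodule.span_induction with
    | mem x hx =>
      obtain ⟨l, hl, rfl⟩ := hx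
      refine Submodule.subset_span ⟨i :: j :: l, ?_, by simp [mul_assoc]⟩
      simpa [Nat.even_add_one] using hl
    | zero => simp
    | add x y _ _ hx hy => rw [mul_add]; exact Submodule.add_mem _ hx hy
    | smul r x _ hx => rw [mul_smul_comm]; exact Submodule.smul_mem _ _ hx

namespace CliffordOrientation

variable (o : CliffordOrientation Q)

/-- The product `p` of the basis vectors differs from its reversal by a sign, and `p` times its
reversal is ∏ Q(b i). So z² = 1 reads ±c²∏ Q(b i) = 1, and every factor is a unit. -/
theorem exists_basis_isUnit [Invertible (2 : R)] :
    ∃ (b : Module.Basis (Fin (Module.finrank R M)) R M) (c : R),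
    (∀ i j, i ≠ j → CliffordAlgebra.ι Q (b i) * CliffordAlgebra.ι Q (b j) =
      -(CliffordAlgebra.ι Q (b j) * CliffordAlgebra.ι Q (b i))) ∧
    (o.z : CliffordAlgebra Q) =
      c • ((List.finRange (Module.finrank R M)).map fun i => CliffordAlgebra.ι Q (b i)).prod ∧
    IsUnit c ∧ ∀ i, IsUnit (Q (b i)) := by
  obtain ⟨b, c, hb, hz⟩ := o.exists_basis
  rw [List.ofFn_eq_map] at hz
  have hg : ∀ i j, i ≠ j → CliffordAlgebra.ι Q (b i) * CliffordAlgebra.ι Q (b j) =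
      -(CliffordAlgebra.ι Q (b j) * CliffordAlgebra.ι Q (b i)) :=
    fun i j h => ι_mul_ι_of_polar_eq_zero (hb i j h)
  have h1 : (o.z : CliffordAlgebra Q) * o.z = 1 := congrArg Subtype.val o.sq_eq_one
  have h2 := prod_map_mul_prod_map_reverse (g := fun i => CliffordAlgebra.ι Q (b i))
    (q := fun i => Q (b i)) (fun i => CliffordAlgebra.ι_sq_scalar Q (b i)) (List.finRange _)
  set p := ((List.finRange (Module.finrank R M)).map fun i => CliffordAlgebra.ι Q (b i)).prod
  have h3 : ∃ s : R, s * (c * c * ((List.finRange (Module.finrank R M)).map fun i =>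
      Q (b i)).prod) = 1 := by
    have h4 : ∃ s : R, p = s • ((List.finRange (Module.finrank R M)).reverse.map fun i =>
        CliffordAlgebra.ι Q (b i)).prod := by
      rcases prod_map_perm_of_anticommute hg (List.reverse_perm (List.finRange _)).symm with h | h
      · exact ⟨1, by rw [one_smul]; exact h⟩
      · exact ⟨-1, by rw [neg_one_smul]; exact h⟩
    obtain ⟨s, hs⟩ := h4
    refine ⟨s, ?_⟩
    -- The retraction onto scalars turns an identity in the Clifford algebra into one in `R`.
    rw [← cliffordScalarPart_algebraMap Q (s * _), ← cliffordScalarPart_algebraMap Q 1]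
    congr 1
    have h5 : p * p = s • algebraMap R _ ((List.finRange (Module.finrank R M)).map fun i =>
        Q (b i)).prod := by
      rw [← h2, ← mul_smul_comm, ← hs]
    rw [map_one, ← h1, hz, smul_mul_smul_comm, h5, smul_smul, Algebra.smul_def, ← map_mul]
    congr 1
    ring
  obtain ⟨s, hs⟩ := h3
  refine ⟨b, c, hg, hz, isUnit_of_dvd_one ⟨s * (c *
    ((List.finRange (Module.finrank R M)).map fun i => Q (b i)).prod), by rw [← hs]; ring⟩,
    fun i => ?_⟩
  refine isUnit_of_dvd_unit ?_ (IsUnit.of_mul_eq_one_right _ hs)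
  exact (List.dvd_prod (List.mem_map.mpr ⟨i, List.mem_finRange i, rfl⟩)).mul_left _

/-- A basis vector passes an even number n of letters, exactly one of which is itself: n - 1 signs,
an odd number. -/
theorem z_mul_ι (v : M) : (o.z : CliffordAlgebra Q) * CliffordAlgebra.ι Q v =
    -(CliffordAlgebra.ι Q v * o.z) := by
  obtain ⟨b, c, hb, hz⟩ := o.exists_basis
  rw [List.ofFn_eq_map] at hz
  have h : ∀ i, (o.z : CliffordAlgebra Q) * CliffordAlgebra.ι Q (b i) =
      -(CliffordAlgebra.ι Q (b i) * o.z) := by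
    intro i
    have hc : Even (Module.finrank R M) := (by decide : Even 4).trans_dvd o.four_dvd
    have := mul_prod_map_of_anticommute (R := R) (g := fun i => CliffordAlgebra.ι Q (b i))
      (fun i j h => ι_mul_ι_of_polar_eq_zero (hb i j h)) i (List.finRange _)
    rw [List.count_eq_one_of_mem (List.nodup_finRange _) (List.mem_finRange i),
      List.length_finRange, hc.add_one.neg_one_pow, neg_one_smul] at this
    rw [hz, mul_smul_comm, this, smul_mul_assoc, smul_neg, neg_neg]
  have h2 : (LinearMap.mulLeft R (o.z : CliffordAlgebra Q) + LinearMap.mulRight R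
      (o.z : CliffordAlgebra Q)) ∘ₗ CliffordAlgebra.ι Q = 0 := by
    refine b.ext fun i => ?_
    simp [h i]
  have := LinearMap.congr_fun h2 v
  exact eq_neg_of_add_eq_zero_left this

theorem z_comm (x : CliffordAlgebra.even Q) : o.z * x = x * o.z := by
  apply Subtype.ext
  obtain ⟨x, hx⟩ := x
  change (o.z : CliffordAlgebra Q) * x = x * o.z
  induction x, hx using CliffordAlgebra.even_induction with
  | algebraMap r => exact (Algebra.commutes _ _).symm
  | add x y _ _ hx hy => rw [mul_add, add_mul, hx, hy]
  | ι_mul_ι_mul m₁ m₂ x _ hx =>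
    rw [mul_assoc, ← mul_assoc (o.z : CliffordAlgebra Q), o.z_mul_ι, neg_mul, mul_assoc,
      ← mul_assoc (o.z : CliffordAlgebra Q), o.z_mul_ι, neg_mul, mul_assoc _ _ x, hx]
    simp [mul_assoc]

end CliffordOrientation

end Orientation

/-! ### The two components and conjugation by a vector -/

section Components

variable {R M : Type*} [CommRing R] [AddCommGroup M] [Module R M] {Q : QuadraticForm R M}

/-- Conjugation of the even Clifford algebra by an invertible vector. -/
def vectorConj (v : M) (u : Rˣ) (h : Q v = u) :
    CliffordAlgebra.even Q →ₐ[R] CliffordAlgebra.even Q :=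
  AlgHom.codRestrict
    (AlgHom.ofLinearMap
      ((↑u⁻¹ : R) • (LinearMap.mulLeftRight R
        (CliffordAlgebra.ι Q v, CliffordAlgebra.ι Q v)) ∘ₗ (CliffordAlgebra.even Q).val.toLinearMap)
      (by simp [CliffordAlgebra.ι_sq_scalar, h, Algebra.smul_def, ← map_mul])
      (fun x y => by
        simp only [LinearMap.smul_apply, LinearMap.comp_apply, LinearMap.mulLeftRight_apply,
          AlgHom.toLinearMap_apply, Subalgebra.coe_val, Subalgebra.coe_mul]
        have : ∀ a b : CliffordAlgebra Q, CliffordAlgebra.ι Q v * a * CliffordAlgebra.ι Q v *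
            (CliffordAlgebra.ι Q v * b * CliffordAlgebra.ι Q v) =
            (u : R) • (CliffordAlgebra.ι Q v * (a * b) * CliffordAlgebra.ι Q v) := by
          intro a b
          calc _ = CliffordAlgebra.ι Q v * a * (CliffordAlgebra.ι Q v * CliffordAlgebra.ι Q v) *
                (b * CliffordAlgebra.ι Q v) := by simp only [mul_assoc]
            _ = _ := by
              rw [CliffordAlgebra.ι_sq_scalar, h, ← Algebra.commutes, ← Algebra.smul_def,
                smul_mul_assoc]
              simp only [mul_assoc]
        rw [smul_mul_smul_comm, this, smul_smul, mul_assoc (↑u⁻¹ : R), Units.inv_mul, mul_one]))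
    (CliffordAlgebra.even Q) (fun x => by
      refine Subalgebra.smul_mem _ ?_ _
      have h1 : CliffordAlgebra.ι Q v * x * CliffordAlgebra.ι Q v ∈
          CliffordAlgebra.evenOdd Q (1 + 0 + 1) :=
        SetLike.mul_mem_graded (SetLike.mul_mem_graded (CliffordAlgebra.ι_mem_evenOdd_one Q v) x.2)
          (CliffordAlgebra.ι_mem_evenOdd_one Q v)
      exact h1)

theorem coe_vectorConj (v : M) (u : Rˣ) (h : Q v = u) (x : CliffordAlgebra.even Q) :
    (vectorConj v u h x : CliffordAlgebra Q) =
      (↑u⁻¹ : R) • (CliffordAlgebra.ι Q v * x * CliffordAlgebra.ι Q v) :=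
  rfl

theorem vectorConj_vectorConj (v : M) (u : Rˣ) (h : Q v = u) (x : CliffordAlgebra.even Q) :
    vectorConj v u h (vectorConj v u h x) = x := by
  apply Subtype.ext
  rw [coe_vectorConj, coe_vectorConj, mul_smul_comm, smul_mul_assoc, smul_smul]
  calc _ = (↑u⁻¹ * ↑u⁻¹ : R) • (CliffordAlgebra.ι Q v * CliffordAlgebra.ι Q v * x *
        (CliffordAlgebra.ι Q v * CliffordAlgebra.ι Q v)) := by simp only [mul_assoc]
    _ = _ := by
      rw [CliffordAlgebra.ι_sq_scalar, h, ← Algebra.commutes, ← Algebra.smul_def, ← Algebra.smul_def,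
        smul_smul, smul_smul]
      simp [mul_assoc]

theorem evenInvolution_vectorConj (v : M) (u : Rˣ) (h : Q v = u) (x : CliffordAlgebra.even Q) :
    evenInvolution Q (vectorConj v u h x) = vectorConj v u h (evenInvolution Q x) := by
  apply Subtype.ext
  simp [coe_vectorConj, mul_assoc]

namespace CliffordOrientation

variable (o : CliffordOrientation Q)

/-- The element `z` anticommutes with vectors; for this reason conjugation by a vector exchanges the
components. -/
theorem vectorConj_z (v : M) (u : Rˣ) (h : Q v = u) : vectorConj v u h o.z = -o.z := by
  apply Subtype.ext
  have := o.z_mul_ι v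
  rw [coe_vectorConj, mul_assoc, this, mul_neg, ← mul_assoc, CliffordAlgebra.ι_sq_scalar, h,
    ← Algebra.smul_def, smul_neg, smul_smul]
  simp

variable [Invertible (2 : R)]

theorem idem_comm (x : CliffordAlgebra.even Q) : o.idem * x = x * o.idem := by
  rw [idem, smul_mul_assoc, mul_smul_comm, add_mul, mul_add, o.z_comm, one_mul, mul_one]

theorem neg_idem : o.neg.idem = 1 - o.idem := by
  rw [eq_sub_iff_add_eq, idem, idem, ← smul_add]
  have : o.neg.z = -o.z := rfl
  rw [this, show 1 + -o.z + (1 + o.z) = (2 : R) • (1 : CliffordAlgebra.even Q) by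
    rw [two_smul]; abel, smul_smul, invOf_mul_self, one_smul]

theorem vectorConj_idem (v : M) (u : Rˣ) (h : Q v = u) :
    vectorConj v u h o.idem = o.neg.idem := by
  rw [idem, map_smul, map_add, map_one, vectorConj_z]
  rfl

/-- The projection of the even Clifford algebra to a component. -/
def toComponent : CliffordAlgebra.even Q →ₐ[R] o.Component :=
  AlgHom.ofLinearMap
    { toFun := fun x => ⟨o.idem * x * o.idem, x, rfl⟩
      map_add' := fun x y => Subtype.ext (by
        change o.idem * (x + y) * o.idem = o.idem * x * o.idem + o.idem * y * o.idem
        rw [mul_add, add_mul])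
      map_smul' := fun r x => Subtype.ext (by
        change o.idem * (r • x) * o.idem = r • (o.idem * x * o.idem)
        rw [mul_smul_comm, smul_mul_assoc]) }
    (Subtype.ext (by
      change o.idem * 1 * o.idem = o.idem
      rw [mul_one, o.isIdempotentElem_idem.eq]))
    (fun x y => Subtype.ext (by
      change o.idem * (x * y) * o.idem = o.idem * x * o.idem * (o.idem * y * o.idem)
      have h := o.isIdempotentElem_idem.eq
      simp only [o.idem_comm, mul_assoc, h]))

theorem coe_toComponent (x : CliffordAlgebra.even Q) : (o.toComponent x).1 = o.idem * x := by
  change o.idem * x * o.idem = _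
  rw [o.idem_comm, mul_assoc, o.isIdempotentElem_idem.eq]

theorem toComponent_coe (x : o.Component) : o.toComponent x.1 = x :=
  Subtype.ext (by rw [coe_toComponent]; exact congrArg Subtype.val (one_mul x))

theorem toComponent_surjective : Function.Surjective o.toComponent :=
  fun x => ⟨x.1, o.toComponent_coe x⟩

theorem toComponent_idem : o.toComponent o.idem = 1 := o.toComponent_coe 1

theorem toComponent_neg_idem : o.toComponent o.neg.idem = 0 := by
  rw [neg_idem, map_sub, map_one, toComponent_idem, sub_self]

theorem toComponent_z : o.toComponent o.z = 1 := by
  have h : o.z = (2 : R) • o.idem - 1 := by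
    rw [idem, smul_smul, mul_invOf_self, one_smul, add_sub_cancel_left]
  rw [h, map_sub, map_smul, map_one, toComponent_idem, two_smul, add_sub_cancel_right]

theorem componentInvolution_toComponent (x : CliffordAlgebra.even Q) :
    o.componentInvolution (o.toComponent x) = o.toComponent (evenInvolution Q x) := by
  apply Subtype.ext
  change evenInvolution Q (o.toComponent x).1 = _
  rw [coe_toComponent, coe_toComponent, evenInvolution_mul, evenInvolution_idem, o.idem_comm]

/-- The even Clifford algebra is the product of its two components. -/
theorem isoWithInvolution_prod : IsoWithInvolution R (evenInvolution Q)
    (o.componentInvolution.prodMap o.neg.componentInvolution) := by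
  refine ⟨AlgEquiv.ofBijective (o.toComponent.prod o.neg.toComponent) ⟨?_, ?_⟩, fun x => ?_⟩
  · rw [injective_iff_map_eq_zero]
    intro x hx
    have h1 : o.idem * x = 0 := by
      rw [← coe_toComponent, show o.toComponent x = 0 from congrArg Prod.fst hx]
      rfl
    have h2 : o.neg.idem * x = 0 := by
      rw [← coe_toComponent, show o.neg.toComponent x = 0 from congrArg Prod.snd hx]
      rfl
    rw [← one_mul x, ← add_sub_cancel o.idem 1, ← neg_idem, add_mul, h1, h2, add_zero]
  · rintro ⟨x, y⟩
    refine ⟨o.idem * x.1 + o.neg.idem * y.1, ?_⟩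
    have h1 : o.toComponent (o.idem * x.1 + o.neg.idem * y.1) = x := by
      rw [map_add, map_mul, map_mul, toComponent_idem, toComponent_neg_idem, toComponent_coe]
      simp
    have h2 : o.neg.toComponent (o.idem * x.1 + o.neg.idem * y.1) = y := by
      have h3 : o.neg.toComponent o.idem = 0 := by
        have := o.neg_idem
        rw [show o.idem = 1 - o.neg.idem by rw [this]; abel, map_sub, map_one, toComponent_idem,
          sub_self]
      rw [map_add, map_mul, map_mul, toComponent_idem, h3, toComponent_coe]
      simp
    exact Prod.ext h1 h2
  · exact Prod.ext (o.componentInvolution_toComponent x).symm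
      (o.neg.componentInvolution_toComponent x).symm

theorem neg_toComponent_vectorConj_idem (v : M) (u : Rˣ) (h : Q v = u)
    (x : CliffordAlgebra.even Q) :
    o.neg.toComponent (vectorConj v u h (o.idem * x)) = o.neg.toComponent (vectorConj v u h x) := by
  rw [map_mul, vectorConj_idem, map_mul, toComponent_idem, one_mul]

/-- The two components are isomorphic if the form represents a unit. -/
theorem isoWithInvolution_neg (v : M) (u : Rˣ) (h : Q v = u) :
    IsoWithInvolution R o.componentInvolution o.neg.componentInvolution := by
  have hn : o.neg.neg.idem = o.idem := by rw [neg_idem, neg_idem]; abel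
  let f : o.Component →ₐ[R] o.neg.Component := AlgHom.ofLinearMap
    (o.neg.toComponent.toLinearMap ∘ₗ (vectorConj v u h).toLinearMap ∘ₗ
      { toFun := fun x => x.1, map_add' := fun _ _ => rfl, map_smul' := fun _ _ => rfl })
    (by
      change o.neg.toComponent (vectorConj v u h o.idem) = 1
      rw [vectorConj_idem, toComponent_idem])
    (fun x y => by
      change o.neg.toComponent (vectorConj v u h (x.1 * y.1)) = _
      rw [map_mul, map_mul]
      rfl)
  have hf : ∀ x, f (o.toComponent x) = o.neg.toComponent (vectorConj v u h x) := fun x => by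
    change o.neg.toComponent (vectorConj v u h (o.toComponent x).1) = _
    rw [coe_toComponent, neg_toComponent_vectorConj_idem]
  refine ⟨AlgEquiv.ofBijective f ⟨?_, fun y => ?_⟩, fun x => ?_⟩
  · rw [injective_iff_map_eq_zero]
    intro x hx
    obtain ⟨x, rfl⟩ := o.toComponent_surjective x
    rw [hf] at hx
    have h1 : o.neg.idem * vectorConj v u h x = 0 := by rw [← coe_toComponent, hx]; rfl
    -- Conjugating once more carries the opposite idempotent back to `o.idem` and undoes the
    -- conjugation of `x`.
    have h2 := congrArg (vectorConj v u h) h1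
    rw [map_mul, vectorConj_idem, vectorConj_vectorConj, map_zero, hn] at h2
    exact Subtype.ext (by rw [coe_toComponent, h2]; rfl)
  · exact ⟨o.toComponent (vectorConj v u h y.1), by
      rw [hf, vectorConj_vectorConj, toComponent_coe]⟩
  · obtain ⟨x, rfl⟩ := o.toComponent_surjective x
    change f (o.componentInvolution _) = o.neg.componentInvolution (f _)
    rw [componentInvolution_toComponent, hf, hf, componentInvolution_toComponent, evenInvolution_vectorConj]

end CliffordOrientation

end Components

/-! ### Averages in the even Clifford algebra -/

section AverageEven

variable {R M : Type*} [CommRing R] [AddCommGroup M] [Module R M] {Q : QuadraticForm R M}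

/-- The product of two vectors, as an element of the even Clifford algebra. -/
abbrev evenPair (Q : QuadraticForm R M) (v w : M) : CliffordAlgebra.even Q :=
  (CliffordAlgebra.even.ι Q).bilin v w

theorem coe_evenPair (v w : M) :
    (evenPair Q v w : CliffordAlgebra Q) = CliffordAlgebra.ι Q v * CliffordAlgebra.ι Q w :=
  rfl

theorem evenPair_mul_evenPair_swap (v w : M) (a b : R) (h : a * (b * (Q w * Q v)) = 1) :
    evenPair Q v w * (a • b • evenPair Q w v) = 1 := by
  apply Subtype.ext
  change CliffordAlgebra.ι Q v * CliffordAlgebra.ι Q w *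
    (a • b • (CliffordAlgebra.ι Q w * CliffordAlgebra.ι Q v)) = 1
  rw [mul_smul_comm, mul_smul_comm, mul_assoc, ← mul_assoc (CliffordAlgebra.ι Q w),
    CliffordAlgebra.ι_sq_scalar, ← Algebra.smul_def, mul_smul_comm, CliffordAlgebra.ι_sq_scalar,
    Algebra.algebraMap_eq_smul_one, smul_smul, smul_smul, smul_smul,
    show a * b * Q w * Q v = 1 by rw [← h]; ring, one_smul]

/-- The product of two vectors with invertible values, as a unit of the even Clifford algebra. -/
def evenPairUnit (v w : M) (hv : IsUnit (Q v)) (hw : IsUnit (Q w)) :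
    (CliffordAlgebra.even Q)ˣ where
  val := evenPair Q v w
  inv := (↑hv.unit⁻¹ : R) • (↑hw.unit⁻¹ : R) • evenPair Q w v
  val_inv := evenPair_mul_evenPair_swap v w _ _ (by
    rw [← mul_assoc (↑hw.unit⁻¹ : R), IsUnit.val_inv_mul, one_mul, IsUnit.val_inv_mul])
  inv_val := by
    have := evenPair_mul_evenPair_swap (Q := Q) w v (↑hw.unit⁻¹ : R) (↑hv.unit⁻¹ : R) (by
      rw [← mul_assoc (↑hv.unit⁻¹ : R), IsUnit.val_inv_mul, one_mul, IsUnit.val_inv_mul])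
    rwa [mul_smul_comm, mul_smul_comm, smul_comm, ← smul_mul_assoc, ← smul_mul_assoc] at this

theorem prod_map_ι_mem_even {I : Type*} (f : I → M) (l : List I) (hl : Even l.length) :
    (l.map fun i => CliffordAlgebra.ι Q (f i)).prod ∈ CliffordAlgebra.even Q := by
  have := SetLike.list_prod_map_mem_graded (A := CliffordAlgebra.evenOdd Q) l (fun _ => 1)
    (fun i => CliffordAlgebra.ι Q (f i)) (fun i _ => CliffordAlgebra.ι_mem_evenOdd_one Q (f i))
  have h : (l.map fun _ => (1 : ZMod 2)).sum = 0 := by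
    rw [List.map_const', List.sum_replicate, nsmul_one, ZMod.natCast_eq_zero_iff_even]
    exact hl
  rw [h] at this
  exact this

theorem sum_count_eq_length {I : Type*} [Fintype I] [DecidableEq I] (l : List I) :
    ∑ i, l.count i = l.length := by
  induction l with
  | nil => simp
  | cons a l ih => simp [List.count_cons, Finset.sum_add_distrib, ih]

/-- The sum of all these numbers is `Fintype.card I * l.count i₀ + l.length`, which is even, so the
parity at the one index `i₁` left out is forced by the others. -/
theorem even_count_iff {I : Type*} [Fintype I] [DecidableEq I] (l : List I)
    (hl : Even l.length) (hI : Even (Fintype.card I)) (i₀ i₁ : I)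
    (h : ∀ j, j ≠ i₁ → Even (l.count i₀ + l.count j)) (j : I) :
    Even (l.count i₀ + l.count j) := by
  rcases ne_or_eq j i₁ with hj | rfl
  · exact h j hj
  · have h1 : ∑ i, (l.count i₀ + l.count i) = Fintype.card I * l.count i₀ + l.length := by
      rw [Finset.sum_add_distrib, sum_count_eq_length]
      simp
    have h2 : Even (∑ i, (l.count i₀ + l.count i)) := by
      rw [h1]
      exact (hI.mul_right _).add hl
    rw [← Finset.add_sum_erase _ _ (Finset.mem_univ j), Nat.even_add] at h2
    exact h2.mpr (Finset.even_sum _ fun i hi => h i (Finset.ne_of_mem_erase hi))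

variable [Invertible (2 : R)]

/-- Conjugation by a pair multiplies a word by a sign; the average keeps the word if the sign is +
and kills it otherwise. -/
theorem conjAverage_evenPairUnit {I : Type*} [DecidableEq I] (b : I → M)
    (hb : ∀ i j, i ≠ j → CliffordAlgebra.ι Q (b i) * CliffordAlgebra.ι Q (b j) =
      -(CliffordAlgebra.ι Q (b j) * CliffordAlgebra.ι Q (b i)))
    (hQ : ∀ i, IsUnit (Q (b i))) (i₀ : I) (js l : List I) (hl : Even l.length) :
    conjAverage R (js.map fun j => evenPairUnit (b i₀) (b j) (hQ i₀) (hQ j))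
        ⟨_, prod_map_ι_mem_even b l hl⟩ =
      if ∀ j ∈ js, Even (l.count i₀ + l.count j) then ⟨_, prod_map_ι_mem_even b l hl⟩ else 0 := by
  induction js with
  | nil => simp
  | cons j js ih =>
    rw [List.map_cons, conjAverage_cons, ih]
    by_cases h : ∀ j ∈ js, Even (l.count i₀ + l.count j)
    · rw [if_pos h]
      have h1 : (evenPairUnit (b i₀) (b j) (hQ i₀) (hQ j) : CliffordAlgebra.even Q) *
          ⟨_, prod_map_ι_mem_even b l hl⟩ = (-1 : R) ^ (l.count i₀ + l.count j) •
          (⟨_, prod_map_ι_mem_even b l hl⟩ * (evenPairUnit (b i₀) (b j) (hQ i₀) (hQ j) :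
            CliffordAlgebra.even Q)) :=
        Subtype.ext (mul_mul_prod_map_of_anticommute (R := R) hb i₀ j l)
      rw [h1, smul_mul_assoc, mul_assoc, Units.mul_inv, mul_one]
      by_cases h2 : Even (l.count i₀ + l.count j)
      · rw [h2.neg_one_pow, one_smul, invOf_two_smul_add_self, if_pos (by simpa [h2] using h)]
      · rw [(Nat.not_even_iff_odd.mp h2).neg_one_pow, neg_one_smul, add_neg_cancel, smul_zero,
          if_neg (by simp [h2])]
    · rw [if_neg h, if_neg (fun h' => h fun k hk => h' k (by simp [hk]))]
      simp

/-- The averages over conjugations by products of two vectors of an orthogonal basis project the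
even Clifford algebra to `R + R z`, and detect nonzero elements. -/
theorem CliffordOrientation.exists_conjAverage (o : CliffordOrientation Q)
    (hM : Module.finrank R M ≠ 0) : ∃ us : List (CliffordAlgebra.even Q)ˣ,
      (∀ x, ∃ r s : R, conjAverage R us x = r • 1 + s • o.z) ∧
      ∀ x, (∀ y, conjAverage R us (x * y) = 0) → x = 0 := by
  obtain ⟨b, c, hb, hz, -, hQ⟩ := o.exists_basis_isUnit
  obtain ⟨k, hk⟩ := o.four_dvd
  generalize Module.finrank R M = m at *
  let i₀ : Fin m := ⟨0, by omega⟩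
  let i₁ : Fin m := ⟨m - 1, by omega⟩
  have h01 : i₀ ≠ i₁ := fun h => by have := congrArg Fin.val h; simp [i₀, i₁] at this; omega
  have hme : Even m := ⟨2 * k, by omega⟩
  -- The index `i₁` is held back: it supplies the anticommuting partners needed for the second
  -- assertion, and parity makes it dispensable for the first.
  let js : List (Fin m) := (List.finRange m).filter fun j => j ≠ i₀ ∧ j ≠ i₁
  have hjs : ∀ j, j ∈ js ↔ j ≠ i₀ ∧ j ≠ i₁ := fun j => by simp [js]
  refine ⟨js.map fun j => evenPairUnit (b i₀) (b j) (hQ i₀) (hQ j), fun x => ?_, fun x => ?_⟩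
  · let S : Submodule R (CliffordAlgebra.even Q) := (Submodule.span R {1, o.z}).comap
      (conjAverage R (js.map fun j => evenPairUnit (b i₀) (b j) (hQ i₀) (hQ j)))
    have hS : Submodule.span R {x | ∃ l : List (Fin m), Even l.length ∧
        x = (l.map fun i => CliffordAlgebra.ι Q (b i)).prod} ≤
        S.map (CliffordAlgebra.even Q).val.toLinearMap := by
      rw [Submodule.span_le]
      rintro _ ⟨l, hl, rfl⟩
      refine ⟨⟨_, prod_map_ι_mem_even b l hl⟩, ?_, rfl⟩
      change conjAverage R _ _ ∈ Submodule.span R {1, o.z}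
      rw [conjAverage_evenPairUnit b hb hQ _ _ _ hl]
      split_ifs with h
      · have h1 : ∀ j, Even (l.count i₀ + l.count j) := by
          refine even_count_iff l hl (by simpa using hme) i₀ i₁ fun j hj => ?_
          by_cases hj' : j = i₀
          · rw [hj']; exact ⟨_, rfl⟩
          · exact h j ((hjs j).mpr ⟨hj', hj⟩)
        -- A surviving word has all its counts of the same parity. If they are even, it is a scalar.
        -- If they are odd, its product with `z` is a scalar, so the word is a multiple of z⁻¹ = z.
        by_cases h2 : Even (l.count i₀)
        · obtain ⟨r, hr⟩ := exists_prod_map_eq_algebraMap hb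
            (fun i => CliffordAlgebra.ι_sq_scalar Q (b i)) l
            fun j => (Nat.even_add.mp (h1 j)).mp h2
          refine Submodule.mem_span_pair.mpr ⟨r, 0, Subtype.ext ?_⟩
          change _ = (l.map fun i => CliffordAlgebra.ι Q (b i)).prod
          rw [hr, zero_smul, add_zero, Algebra.algebraMap_eq_smul_one]
          rfl
        · obtain ⟨r, hr⟩ := exists_prod_map_eq_algebraMap hb
            (fun i => CliffordAlgebra.ι_sq_scalar Q (b i)) (l ++ List.finRange m) fun j => by
              rw [List.count_append,
                List.count_eq_one_of_mem (List.nodup_finRange _) (List.mem_finRange j)]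
              exact (Nat.not_even_iff_odd.mp fun h => h2 ((Nat.even_add.mp (h1 j)).mpr h)).add_one
          refine Submodule.mem_span_pair.mpr ⟨0, c * r, Subtype.ext ?_⟩
          change _ = (l.map fun i => CliffordAlgebra.ι Q (b i)).prod
          rw [zero_smul, zero_add]
          change (c * r) • (o.z : CliffordAlgebra Q) = _
          have h3 : (l.map fun i => CliffordAlgebra.ι Q (b i)).prod * (o.z : CliffordAlgebra Q) =
              algebraMap R _ (c * r) := by
            rw [hz, mul_smul_comm, ← List.prod_append, ← List.map_append, hr, map_mul,
              Algebra.smul_def]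
          rw [Algebra.smul_def, ← h3, mul_assoc,
            show (o.z : CliffordAlgebra Q) * o.z = 1 from congrArg Subtype.val o.sq_eq_one, mul_one]
      · exact zero_mem _
    obtain ⟨y, hy, hyx⟩ := hS (even_le_span_prod b x.2)
    obtain rfl : y = x := Subtype.ext hyx
    obtain ⟨r, s, h⟩ := Submodule.mem_span_pair.mp hy
    exact ⟨r, s, h.symm⟩
  -- The partner of b(i₀)b(j) is b(j)b(i₁): products of two basis vectors anticommute when they
  -- share exactly one index and commute when they share none.
  · refine eq_zero_of_conjAverage_mul_eq_zero R _
      (fun j => evenPairUnit (b j) (b i₁) (hQ j) (hQ i₁)) js ((List.nodup_finRange m).filter _)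
      (fun j hj => ?_) (fun i hi j hj hij => ?_)
    · have := mul_mul_prod_map_of_anticommute (R := R) hb i₀ j [j, i₁]
      obtain ⟨h2, h3⟩ := (hjs j).mp hj
      simp [h01.symm, h2, h3.symm] at this
      exact Subtype.ext this
    · have := mul_mul_prod_map_of_anticommute (R := R) hb i₀ i [j, i₁]
      obtain ⟨h2, h3⟩ := (hjs i).mp hi
      obtain ⟨h4, h5⟩ := (hjs j).mp hj
      simp [h01.symm, h4, h3.symm, hij.symm] at this
      exact Subtype.ext this

end AverageEven

/-! ### The algebra `B ⊗ {}^ι B`, its switch map and its centre -/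

section ConjugateTensor

variable {F L : Type*} [CommRing F] [CommRing L] [Algebra F L] (ι : L →ₐ[F] L)
  {B : Type*} [Ring B] [Algebra L B]

/-- The map `b ↦ b ⊗ 1`. -/
def conjInl : B →ₐ[L] B ⊗[L] ConjugateAlgebra ι B := Algebra.TensorProduct.includeLeft

/-- The semilinear map `b ↦ 1 ⊗ {}^ι b`. -/
def conjInr : B →+* B ⊗[L] ConjugateAlgebra ι B :=
  (Algebra.TensorProduct.includeRight (R := L) (A := B) (B := ConjugateAlgebra ι B)).toRingHom.comp
    (toConjugate ι B : B →+* ConjugateAlgebra ι B)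

theorem conjInl_apply (b : B) : conjInl ι b = b ⊗ₜ[L] toConjugate ι B 1 := rfl

theorem conjInr_apply (b : B) : conjInr ι b = 1 ⊗ₜ[L] toConjugate ι B b := rfl

theorem conjInl_mul_conjInr (a b : B) :
    conjInl ι a * conjInr ι b = a ⊗ₜ[L] toConjugate ι B b := by
  rw [conjInl_apply, conjInr_apply, Algebra.TensorProduct.tmul_mul_tmul, ← map_mul, mul_one,
    one_mul]

theorem conjInr_mul_conjInl (a b : B) :
    conjInr ι b * conjInl ι a = conjInl ι a * conjInr ι b := by
  rw [conjInl_mul_conjInr, conjInl_apply, conjInr_apply, Algebra.TensorProduct.tmul_mul_tmul,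
    ← map_mul, mul_one, one_mul]

theorem conjInr_smul (hι : ∀ c, ι (ι c) = c) (c : L) (b : B) : conjInr ι (c • b) = ι c • conjInr ι b := by
  rw [conjInr_apply, conjInr_apply, toConjugate_smul ι hι, TensorProduct.tmul_smul]

theorem conjTensor_induction {P : B ⊗[L] ConjugateAlgebra ι B → Prop} (h0 : P 0)
    (h1 : ∀ a b, P (conjInl ι a * conjInr ι b)) (h2 : ∀ s t, P s → P t → P (s + t)) (t) : P t := by
  induction t with
  | zero => exact h0
  | tmul a b =>
    obtain ⟨b, rfl⟩ := (toConjugate ι B).surjective b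
    rw [← conjInl_mul_conjInr]
    exact h1 a b
  | add s t hs ht => exact h2 s t hs ht

theorem switch_conjInl (hι : ∀ c, ι (ι c) = c) (b : B) : switch ι B hι (conjInl ι b) = conjInr ι b := rfl

theorem switch_conjInr (hι : ∀ c, ι (ι c) = c) (b : B) : switch ι B hι (conjInr ι b) = conjInl ι b := rfl

theorem switch_one (hι : ∀ c, ι (ι c) = c) :
    switch ι B hι (1 : B ⊗[L] ConjugateAlgebra ι B) = 1 := rfl

theorem switch_smul (hι : ∀ c, ι (ι c) = c)
    (c : L) (t : B ⊗[L] ConjugateAlgebra ι B) :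
    switch ι B hι (c • t) = ι c • switch ι B hι t := by
  have h : ∀ (c : L), c • (1 : B ⊗[L] ConjugateAlgebra ι B) = conjInl ι (c • 1) := fun c => by
    rw [map_smul, map_one]
  rw [← smul_one_mul, switch_mul, h, switch_conjInl, conjInr_smul ι hι, map_one, smul_one_mul]

theorem switch_switch (hι : ∀ c, ι (ι c) = c)
    (t : B ⊗[L] ConjugateAlgebra ι B) :
    switch ι B hι (switch ι B hι t) = t := by
  induction t using conjTensor_induction with
  | h0 => simp
  | h1 a b => simp only [switch_mul, switch_conjInl, switch_conjInr, conjInr_mul_conjInl]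
  | h2 s t hs ht => rw [map_add, map_add, hs, ht]

variable (σ : B →ₗ[L] B)

theorem map_conjugateMap_inl_mul_inr (a b : B) :
    TensorProduct.map σ (conjugateMap ι σ) (conjInl ι a * conjInr ι b) =
      conjInl ι (σ a) * conjInr ι (σ b) := by
  rw [conjInl_mul_conjInr, conjInl_mul_conjInr]
  rfl

theorem map_conjugateMap_mul (hσ : ∀ a b, σ (a * b) = σ b * σ a)
    (s t : B ⊗[L] ConjugateAlgebra ι B) :
    TensorProduct.map σ (conjugateMap ι σ) (s * t) =
      TensorProduct.map σ (conjugateMap ι σ) t * TensorProduct.map σ (conjugateMap ι σ) s := by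
  induction s using conjTensor_induction with
  | h0 => simp
  | h2 s s' hs hs' => simp only [add_mul, mul_add, map_add, hs, hs']
  | h1 a b =>
    induction t using conjTensor_induction with
    | h0 => simp
    | h2 s s' hs hs' => simp only [add_mul, mul_add, map_add, hs, hs']
    | h1 c d =>
      have h : ∀ a b c d : B, conjInl ι a * conjInr ι b * (conjInl ι c * conjInr ι d) =
          conjInl ι (a * c) * conjInr ι (b * d) := fun a b c d => by
        rw [mul_assoc, ← mul_assoc (conjInr ι b), conjInr_mul_conjInl, map_mul, map_mul]
        simp only [mul_assoc]
      rw [h]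
      simp only [map_conjugateMap_inl_mul_inr]
      rw [h, hσ, hσ]

/-- If averaging over conjugations projects `B` to its scalars, then so it does for
`B ⊗ {}^ι B`, whose centre therefore consists of scalars. -/
theorem exists_eq_smul_one_of_commute (hι : ∀ c, ι (ι c) = c) [Invertible (2 : L)] (us : List Bˣ)
    (hus : ∀ b, ∃ c : L, conjAverage L us b = c • 1) (t : B ⊗[L] ConjugateAlgebra ι B)
    (ht : ∀ s, Commute s t) : ∃ c : L, t = c • 1 := by
  have e1 : ∀ a b, conjAverage L (us.map (Units.map ((conjInl ι : B →ₐ[L] _) : B →* _)))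
      (conjInl ι a * conjInr ι b) = conjInl ι (conjAverage L us a) * conjInr ι b := by
    intro a b
    rw [conjAverage_mul_of_commute, ← map_conjAverage]
    intro u hu
    obtain ⟨u, -, rfl⟩ := List.mem_map.mp hu
    exact (conjInr_mul_conjInl ι (u : B) b).symm
  have h1 : ∀ t, ∃ b : B, conjAverage L (us.map (Units.map ((conjInl ι : B →ₐ[L] _) : B →* _))) t =
      conjInr ι b := by
    intro t
    induction t using conjTensor_induction with
    | h0 => exact ⟨0, by simp⟩
    | h1 a b =>
      obtain ⟨c, hc⟩ := hus a
      refine ⟨ι c • b, ?_⟩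
      rw [e1, hc, map_smul, map_one, conjInr_smul ι hι, hι, smul_one_mul]
    | h2 s t hs ht =>
      obtain ⟨a, ha⟩ := hs
      obtain ⟨b, hb⟩ := ht
      exact ⟨a + b, by rw [map_add, ha, hb, map_add]⟩
  have h2 : ∀ b, switch ι B hι (conjInr ι b) = conjInl ι b := switch_conjInr ι hι
  -- Averaging over the left factor does not change a central `t`, but moves it into the right
  -- factor; hence `t = conjInr ι b`.
  obtain ⟨b, hb⟩ := h1 t
  rw [conjAverage_of_commute] at hb
  · obtain ⟨c, hc⟩ := hus b
    refine ⟨ι c, ?_⟩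
    -- The element `t` also commutes with the switched units; applying the switch, `conjInl ι b`
    -- commutes with the original ones, so averaging fixes it as well.
    have h3 : conjInl ι (conjAverage L us b) = conjInl ι b := by
      rw [map_conjAverage]
      apply conjAverage_of_commute
      intro u hu
      have h4 : Commute (switch ι B hι (u : B ⊗[L] ConjugateAlgebra ι B)) t := ht _
      have h5 := congrArg (switch ι B hι) h4.eq
      rw [switch_mul, switch_mul, switch_switch, hb, h2] at h5
      exact h5
    rw [hc] at h3
    rw [hb, ← switch_conjInl ι hι, ← h3, map_smul, switch_smul, map_one, switch_one]
  · intro u _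
    exact ht u

end ConjugateTensor

/-! ### The homomorphism from the even Clifford algebra of the transfer -/

section TransferHom

variable {F L B V : Type*} [Field F] [CommRing L] [Algebra F L] [Ring B] [Algebra L B]
  [AddCommGroup V] [Module L V]

/-- A linear map `x` from a quadratic space to an algebra with involution which multiplies the
quadratic form by `l`, over an algebra with an involution which negates `δ`. -/
structure SimilitudeData (ι : L →ₐ[F] L) (ψ : QuadraticForm L V) (σ : B →ₗ[L] B) where
  /-- the linear map -/
  x : V →ₗ[L] B
  /-- the multiplier -/
  l : Lˣ
  /-- the skew element -/
  δ : Lˣ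
  conj_conj : ∀ c, ι (ι c) = c
  conj_δ : ι δ = -δ
  σ_mul : ∀ a b, σ (a * b) = σ b * σ a
  σ_σ : ∀ a, σ (σ a) = a
  x_mul_σ : ∀ v, x v * σ (x v) = (l * ψ v) • 1
  σ_mul_x : ∀ v, σ (x v) * x v = (l * ψ v) • 1

namespace SimilitudeData

variable {ι : L →ₐ[F] L} {ψ : QuadraticForm L V} {σ : B →ₗ[L] B} (D : SimilitudeData ι ψ σ)

theorem inl_mul (v : V) : conjInl ι (D.x v) * conjInl ι (σ (D.x v)) = (D.l * ψ v : L) • 1 := by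
  rw [← map_mul, D.x_mul_σ, map_smul, map_one]

theorem inl_mul' (v : V) : conjInl ι (σ (D.x v)) * conjInl ι (D.x v) = (D.l * ψ v : L) • 1 := by
  rw [← map_mul, D.σ_mul_x, map_smul, map_one]

theorem inr_mul (v : V) :
    conjInr ι (D.x v) * conjInr ι (σ (D.x v)) = (ι D.l * ι (ψ v) : L) • 1 := by
  rw [← map_mul, D.x_mul_σ, conjInr_smul ι D.conj_conj, map_one, map_mul]

theorem inr_mul' (v : V) :
    conjInr ι (σ (D.x v)) * conjInr ι (D.x v) = (ι D.l * ι (ψ v) : L) • 1 := by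
  rw [← map_mul, D.σ_mul_x, conjInr_smul ι D.conj_conj, map_one, map_mul]

theorem ι_inv_mul : ι (↑D.l⁻¹ : L) * ι D.l = 1 := by
  rw [← map_mul, Units.inv_mul, map_one]

variable [Algebra F B] [IsScalarTower F L B] [Module F V] [IsScalarTower F L V]

theorem conjInl_smul_base (c : F) (b : B) : conjInl ι (c • b) = c • conjInl ι b := by
  rw [← algebraMap_smul L, map_smul, algebraMap_smul]

omit [Module F V] [IsScalarTower F L V] in
theorem conjInr_smul_base (D : SimilitudeData ι ψ σ) (c : F) (b : B) :
    conjInr ι (c • b) = c • conjInr ι b := by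
  rw [← algebraMap_smul L, conjInr_smul ι D.conj_conj, ι.commutes, algebraMap_smul]

/-- The matrices which describe the action of vectors from the odd to the even part. -/
def rowMap : V →ₗ[F] Matrix (Fin 2) (Fin 2) (B ⊗[L] ConjugateAlgebra ι B) where
  toFun v := !![conjInl ι (D.x v), conjInr ι (D.x v);
    -((↑D.δ⁻¹ * ι ↑D.l⁻¹ : L) • conjInr ι (σ (D.x v))), (↑D.δ⁻¹ * ↑D.l⁻¹ : L) • conjInl ι (σ (D.x v))]
  map_add' v w := by
    ext i j
    fin_cases i <;> fin_cases j <;> simp [add_comm]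
  map_smul' c v := by
    ext i j
    fin_cases i <;> fin_cases j <;>
      simp [conjInl_smul_base, D.conjInr_smul_base, smul_comm c]

/-- The matrices which describe the action of vectors from the even to the odd part. -/
def colMap : V →ₗ[F] Matrix (Fin 2) (Fin 2) (B ⊗[L] ConjugateAlgebra ι B) where
  toFun v := !![(↑D.l⁻¹ : L) • conjInl ι (σ (D.x v)), -((D.δ : L) • conjInr ι (D.x v));
    (ι ↑D.l⁻¹ : L) • conjInr ι (σ (D.x v)), (D.δ : L) • conjInl ι (D.x v)]
  map_add' v w := by
    ext i j
    fin_cases i <;> fin_cases j <;> simp [add_comm]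
  map_smul' c v := by
    ext i j
    fin_cases i <;> fin_cases j <;>
      simp [conjInl_smul_base, D.conjInr_smul_base, smul_comm c]

theorem rowMap_apply (v : V) : D.rowMap v = !![conjInl ι (D.x v), conjInr ι (D.x v);
    -((↑D.δ⁻¹ * ι ↑D.l⁻¹ : L) • conjInr ι (σ (D.x v))),
    (↑D.δ⁻¹ * ↑D.l⁻¹ : L) • conjInl ι (σ (D.x v))] := rfl

theorem colMap_apply (v : V) : D.colMap v =
    !![(↑D.l⁻¹ : L) • conjInl ι (σ (D.x v)), -((D.δ : L) • conjInr ι (D.x v));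
    (ι ↑D.l⁻¹ : L) • conjInr ι (σ (D.x v)), (D.δ : L) • conjInl ι (D.x v)] := rfl

/-- On the diagonal, the left factor contributes ψ(v) and the right factor its conjugate, the
multiplier being divided out. Off the diagonal the two terms cancel because the factors of the
tensor product commute. -/
theorem rowMap_mul_colMap_self (v : V) : D.rowMap v * D.colMap v = (ψ v + ι (ψ v)) • 1 := by
  have h := D.ι_inv_mul
  have h1 : (↑D.l⁻¹ : L) * D.l = 1 := Units.inv_mul _
  have h2 : (↑D.δ⁻¹ : L) * D.δ = 1 := Units.inv_mul _
  rw [rowMap_apply, colMap_apply]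
  ext i j
  fin_cases i <;> fin_cases j <;>
    simp [Matrix.mul_apply, inl_mul, inr_mul, inl_mul', inr_mul', smul_smul, conjInr_mul_conjInl,
      ← add_smul]
  · congr 1
    linear_combination ι (ψ v) * h
  · rw [← neg_smul, ← add_smul]
    convert zero_smul L _ using 2
    ring
  · congr 1
    linear_combination (ι (ψ v) * ι ↑D.l⁻¹ * ι D.l + ψ v * ↑D.l⁻¹ * D.l) * h2 + ψ v * h1 +
      ι (ψ v) * h

theorem colMap_mul_rowMap_self (v : V) : D.colMap v * D.rowMap v = (ψ v + ι (ψ v)) • 1 := by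
  have h := D.ι_inv_mul
  have h1 : (↑D.l⁻¹ : L) * D.l = 1 := Units.inv_mul _
  have h2 : (↑D.δ⁻¹ : L) * D.δ = 1 := Units.inv_mul _
  rw [rowMap_apply, colMap_apply]
  ext i j
  fin_cases i <;> fin_cases j <;>
    simp [Matrix.mul_apply, inl_mul, inr_mul, inl_mul', inr_mul', smul_smul, conjInr_mul_conjInl,
      ← add_smul]
  · congr 1
    linear_combination (ι (ψ v) * ι ↑D.l⁻¹ * ι D.l) * h2 + ι (ψ v) * h
  · rw [← neg_smul, ← add_smul]
    convert zero_smul L _ using 2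
    linear_combination -↑D.l⁻¹ * h2
  · rw [← neg_smul, ← add_smul]
    convert zero_smul L _ using 2
    linear_combination -ι ↑D.l⁻¹ * h2
  · congr 1
    linear_combination (ψ v * ↑D.l⁻¹ * D.l) * h2 + ψ v * h1 + ι (ψ v) * h

/-- In this form the effect of the switch, of the involution and of scaling `v` and `w` by `δ` can
be read off entry by entry. -/
theorem rowMap_mul_colMap (v w : V) : D.rowMap v * D.colMap w =
    !![(↑D.l⁻¹ : L) • conjInl ι (D.x v * σ (D.x w)) +
        ι ↑D.l⁻¹ • conjInr ι (D.x v * σ (D.x w)),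
      (D.δ : L) • (conjInl ι (D.x w) * conjInr ι (D.x v) - conjInl ι (D.x v) * conjInr ι (D.x w));
      (↑D.δ⁻¹ * (↑D.l⁻¹ * ι ↑D.l⁻¹) : L) • (conjInl ι (σ (D.x v)) * conjInr ι (σ (D.x w)) -
        conjInl ι (σ (D.x w)) * conjInr ι (σ (D.x v))),
      (↑D.l⁻¹ : L) • conjInl ι (σ (D.x v) * D.x w) + ι ↑D.l⁻¹ • conjInr ι (σ (D.x v) * D.x w)] := by
  rw [rowMap_apply, colMap_apply]
  ext i j
  fin_cases i <;> fin_cases j <;>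
    simp [Matrix.mul_apply, smul_smul, conjInr_mul_conjInl, smul_sub]
  · abel
  · rw [sub_eq_neg_add]
    rw [show (↑D.l⁻¹ * (↑D.δ⁻¹ * ι ↑D.l⁻¹) : L) = ↑D.δ⁻¹ * (↑D.l⁻¹ * ι ↑D.l⁻¹) by ring,
      show (ι ↑D.l⁻¹ * (↑D.δ⁻¹ * ↑D.l⁻¹) : L) = ↑D.δ⁻¹ * (↑D.l⁻¹ * ι ↑D.l⁻¹) by ring]
  · rw [add_comm]

/-- The homomorphism from the even Clifford algebra of the transfer. -/
def evenHom (Q : QuadraticForm F V) (hQ : ∀ v, algebraMap F L (Q v) = ψ v + ι (ψ v)) :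
    CliffordAlgebra.EvenHom Q (Matrix (Fin 2) (Fin 2) (B ⊗[L] ConjugateAlgebra ι B)) where
  bilin := (LinearMap.mul F _).compl₁₂ D.rowMap D.colMap
  contract v := by
    change D.rowMap v * D.colMap v = _
    rw [rowMap_mul_colMap_self, ← hQ, algebraMap_smul, Algebra.algebraMap_eq_smul_one]
  -- Here the product in the other order, `D.colMap v * D.rowMap v`, has to be the same scalar.
  contract_mid u v w := by
    change D.rowMap u * D.colMap v * (D.rowMap v * D.colMap w) = Q v • (D.rowMap u * D.colMap w)
    rw [mul_assoc, ← mul_assoc (D.colMap v), colMap_mul_rowMap_self, ← hQ, algebraMap_smul,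
      smul_one_mul, mul_smul_comm]

variable (Q : QuadraticForm F V) (hQ : ∀ v, algebraMap F L (Q v) = ψ v + ι (ψ v))

/-- The homomorphism from the even Clifford algebra of the transfer. -/
def evenLift : CliffordAlgebra.even Q →ₐ[F]
    Matrix (Fin 2) (Fin 2) (B ⊗[L] ConjugateAlgebra ι B) :=
  CliffordAlgebra.even.lift Q (D.evenHom Q hQ)

theorem evenLift_evenPair (v w : V) :
    D.evenLift Q hQ (evenPair Q v w) = D.rowMap v * D.colMap w :=
  CliffordAlgebra.even.lift_ι Q _ v w

end SimilitudeData

end TransferHom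

/-- Induction for the even Clifford algebra, seen as a subalgebra. -/
theorem even_induction_pair {R M : Type*} [CommRing R] [AddCommGroup M] [Module R M]
    {Q : QuadraticForm R M} {P : CliffordAlgebra.even Q → Prop}
    (h0 : ∀ r, P (algebraMap R _ r)) (h1 : ∀ x y, P x → P y → P (x + y))
    (h2 : ∀ v w x, P x → P (evenPair Q v w * x)) (x : CliffordAlgebra.even Q) : P x := by
  obtain ⟨x, hx⟩ := x
  induction x, hx using CliffordAlgebra.even_induction with
  | algebraMap r => exact h0 r
  | add x y hx hy ihx ihy => exact h1 _ _ ihx ihy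
  | ι_mul_ι_mul v w x hx ih => exact h2 v w _ ih

/-! ### Diagonal adjoint involutions and their compatibility with reversal -/

section AdjointMatrix

variable {F T : Type*} [Field F] [Ring T] [Algebra F T]

/-- The involution of a matrix algebra adjoint to a diagonal form. -/
def diagInvolution (a : Fin 2 → Fˣ) (τ : T →ₗ[F] T) :
    Matrix (Fin 2) (Fin 2) T →ₗ[F] Matrix (Fin 2) (Fin 2) T where
  toFun m := Matrix.of fun i j => (↑(a i)⁻¹ * a j : F) • τ (m j i)
  map_add' m m' := by ext i j; simp
  map_smul' c m := by ext i j; simp [smul_comm c]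

theorem diagInvolution_apply (a : Fin 2 → Fˣ) (τ : T →ₗ[F] T) (m : Matrix (Fin 2) (Fin 2) T)
    (i j : Fin 2) : diagInvolution a τ m i j = (↑(a i)⁻¹ * a j : F) • τ (m j i) := rfl

theorem diagInvolution_mul (a : Fin 2 → Fˣ) (τ : T →ₗ[F] T) (hτ : ∀ s t, τ (s * t) = τ t * τ s)
    (m m' : Matrix (Fin 2) (Fin 2) T) :
    diagInvolution a τ (m * m') = diagInvolution a τ m' * diagInvolution a τ m := by
  ext i j
  simp only [diagInvolution_apply, Matrix.mul_apply, map_sum, hτ, Finset.smul_sum]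
  refine Finset.sum_congr rfl fun k _ => ?_
  rw [smul_mul_smul_comm]
  congr 1
  rw [mul_assoc, Units.mul_inv_cancel_left]

theorem diagInvolution_algebraMap (a : Fin 2 → Fˣ) (τ : T →ₗ[F] T) (hτ : τ 1 = 1) (c : F) :
    diagInvolution a τ (algebraMap F _ c) = algebraMap F _ c := by
  ext i j
  rw [diagInvolution_apply]
  rcases eq_or_ne i j with rfl | h
  · simp [Matrix.algebraMap_matrix_apply, Algebra.algebraMap_eq_smul_one, hτ]
  · simp [Matrix.algebraMap_matrix_apply, h, h.symm]

end AdjointMatrix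

section TransferHom

variable {F L B V : Type*} [Field F] [CommRing L] [Algebra F L] [Ring B] [Algebra L B]
  [AddCommGroup V] [Module L V] [Algebra F B] [IsScalarTower F L B] [Module F V]
  [IsScalarTower F L V]

namespace SimilitudeData

variable {ι : L →ₐ[F] L} {ψ : QuadraticForm L V} {σ : B →ₗ[L] B} (D : SimilitudeData ι ψ σ)
  (Q : QuadraticForm F V) (hQ : ∀ v, algebraMap F L (Q v) = ψ v + ι (ψ v))

/-- Both sides reverse products, so it suffices to compare them on vw ↦ wv. The off-diagonal entries
of the matrix carry the scalars δ and δ⁻¹l⁻¹ι(l)⁻¹; transposition exchanges them, and their ratio is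
`c`. -/
theorem evenLift_evenInvolution (c : Fˣ) (hc : algebraMap F L c = D.δ * D.δ * (D.l * ι D.l))
    (x : CliffordAlgebra.even Q) :
    D.evenLift Q hQ (evenInvolution Q x) = diagInvolution ![1, c]
      ((TensorProduct.map σ (conjugateMap ι σ)).restrictScalars F) (D.evenLift Q hQ x) := by
  have hσ1 : σ 1 = 1 := by
    have := D.σ_mul 1 (σ 1)
    rwa [one_mul, D.σ_σ, one_mul, eq_comm] at this
  have hτ := map_conjugateMap_mul ι σ D.σ_mul
  have hinl : ∀ b, TensorProduct.map σ (conjugateMap ι σ) (conjInl ι b) = conjInl ι (σ b) :=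
    fun b => by
      have := map_conjugateMap_inl_mul_inr ι σ b 1
      rwa [hσ1, map_one, mul_one, mul_one] at this
  have hinr : ∀ b, TensorProduct.map σ (conjugateMap ι σ) (conjInr ι b) = conjInr ι (σ b) :=
    fun b => by
      have := map_conjugateMap_inl_mul_inr ι σ 1 b
      rwa [hσ1, map_one, one_mul, one_mul] at this
  have hτ1 : TensorProduct.map σ (conjugateMap ι σ) 1 = 1 := by
    have := hinl 1
    rwa [hσ1, map_one] at this
  induction x using even_induction_pair with
  | h0 r =>
    have : evenInvolution Q (algebraMap F _ r) = algebraMap F _ r := by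
      rw [Algebra.algebraMap_eq_smul_one, map_smul, evenInvolution_one]
    rw [this, AlgHom.commutes, diagInvolution_algebraMap]
    exact hτ1
  | h1 x y hx hy => simp only [map_add, hx, hy]
  | h2 v w x hx =>
    have h3 : evenInvolution Q (evenPair Q v w) = evenPair Q w v :=
      Subtype.ext (by simp [coe_evenPair])
    rw [evenInvolution_mul, map_mul, hx, h3, map_mul, diagInvolution_mul _ _ hτ]
    congr 1
    rw [evenLift_evenPair, evenLift_evenPair, rowMap_mul_colMap, rowMap_mul_colMap]
    have hd : (↑D.δ⁻¹ : L) * D.δ = 1 := Units.inv_mul _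
    have hl : (↑D.l⁻¹ : L) * D.l = 1 := Units.inv_mul _
    have hl' := D.ι_inv_mul
    have hc' : algebraMap F L ↑c⁻¹ = ↑D.δ⁻¹ * ↑D.δ⁻¹ * (↑D.l⁻¹ * ι ↑D.l⁻¹) := by
      have h : algebraMap F L ↑c⁻¹ * algebraMap F L c = 1 := by
        rw [← map_mul, Units.inv_mul, map_one]
      rw [hc] at h
      calc _ = algebraMap F L ↑c⁻¹ * ((↑D.δ⁻¹ * D.δ) * (↑D.δ⁻¹ * D.δ) * ((↑D.l⁻¹ * D.l) *
            (ι ↑D.l⁻¹ * ι D.l))) := by rw [hd, hl, hl']; ring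
        _ = (algebraMap F L ↑c⁻¹ * (D.δ * D.δ * (D.l * ι D.l))) *
            (↑D.δ⁻¹ * ↑D.δ⁻¹ * (↑D.l⁻¹ * ι ↑D.l⁻¹)) := by ring
        _ = _ := by rw [h, one_mul]
    ext i j
    fin_cases i <;> fin_cases j <;>
      simp only [diagInvolution_apply, Fin.zero_eta, Fin.mk_one, Matrix.cons_val_zero, inv_one,
        Units.val_one, mul_one, one_mul, Matrix.of_apply, Matrix.cons_val', Matrix.cons_val_one,
        LinearMap.restrictScalars_apply, map_add, map_sub, map_smul, hτ, hinl, hinr, D.σ_σ, one_smul,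
        ← algebraMap_smul L (_ : F), map_one, Matrix.cons_val_fin_one, Units.inv_mul,
        hc, hc', map_mul]
    · rw [smul_smul, conjInr_mul_conjInl, conjInr_mul_conjInl]
      congr 1
      linear_combination -(D.δ * (ι ↑D.l⁻¹ * ι D.l)) * hl - D.δ * hl' -
        (D.δ * (ι ↑D.l⁻¹ * ι D.l) * (↑D.l⁻¹ * D.l)) * hd
    · rw [smul_smul, conjInr_mul_conjInl, conjInr_mul_conjInl]
      congr 1
      linear_combination -(↑D.δ⁻¹ * (↑D.l⁻¹ * ι ↑D.l⁻¹)) * hd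

end SimilitudeData

end TransferHom

/-! ### The image of the homomorphism -/

section Surjectivity

variable {F L B V : Type*} [Field F] [CommRing L] [Algebra F L] [Ring B] [Algebra L B]
  [AddCommGroup V] [Module L V] [Algebra F B] [IsScalarTower F L B] [Module F V]
  [IsScalarTower F L V]

namespace SimilitudeData

variable {ι : L →ₐ[F] L} {ψ : QuadraticForm L V} {σ : B →ₗ[L] B} (D : SimilitudeData ι ψ σ)
  (Q : QuadraticForm F V) (hQ : ∀ v, algebraMap F L (Q v) = ψ v + ι (ψ v))

/-- For a product of two vectors, a diagonal entry is an element plus its switch. An off-diagonal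
entry is a switch-antisymmetric element times `δ`, or times `δ⁻¹` and an ι-invariant scalar; ι
negates `δ`, and the signs cancel. -/
theorem evenLift_mem_normAlgebra (x : CliffordAlgebra.even Q) (i j : Fin 2) :
    D.evenLift Q hQ x i j ∈ normAlgebra ι B D.conj_conj := by
  induction x using even_induction_pair generalizing i j with
  | h0 r =>
    rw [AlgHom.commutes, Matrix.algebraMap_matrix_apply]
    split_ifs
    · exact Subalgebra.algebraMap_mem _ r
    · exact zero_mem _
  | h1 x y hx hy =>
    rw [map_add]
    exact add_mem (hx i j) (hy i j)
  | h2 v w x hx =>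
    rw [map_mul, Matrix.mul_apply]
    refine sum_mem fun k _ => mul_mem ?_ (hx k j)
    rw [evenLift_evenPair, rowMap_mul_colMap]
    change switch ι B D.conj_conj _ = _
    have h1 := switch_smul ι (B := B) D.conj_conj
    have h2 := switch_conjInl ι (B := B) D.conj_conj
    have h3 := switch_conjInr ι (B := B) D.conj_conj
    have h4 : ι (↑D.δ⁻¹ : L) = -↑D.δ⁻¹ := by
      have h : (↑D.δ⁻¹ : L) * D.δ = 1 := Units.inv_mul _
      have h' := congrArg ι h
      rw [map_mul, D.conj_δ, map_one, mul_neg, ← neg_mul] at h'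
      linear_combination -(↑D.δ⁻¹ : L) * h' - ι ↑D.δ⁻¹ * h
    fin_cases i <;> fin_cases k <;>
      simp only [Fin.zero_eta, Fin.mk_one, Matrix.cons_val_zero, Matrix.of_apply, Matrix.cons_val',
        Matrix.cons_val_one, Matrix.cons_val_fin_one, map_add, map_sub, h1, h2, h3, switch_mul,
        D.conj_conj, D.conj_δ, conjInr_mul_conjInl, map_mul, h4]
    · exact add_comm _ _
    · rw [neg_smul, ← smul_neg, neg_sub]
    · rw [neg_mul, neg_smul, ← smul_neg, neg_sub, mul_comm (ι _)]
    · exact add_comm _ _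

/-- The `L`-subalgebra generated by the image of the even Clifford algebra of the transfer. -/
def rangeAdjoin : Subalgebra L (Matrix (Fin 2) (Fin 2) (B ⊗[L] ConjugateAlgebra ι B)) :=
  Algebra.adjoin L (Set.range (D.evenLift Q hQ))

/-- With S the image, S + δS is already closed under products, because δ² = d lies in F, and it
contains L = F + Fδ. -/
theorem exists_of_mem_rangeAdjoin (d : F) (hd : algebraMap F L d = D.δ * D.δ)
    (hL : ∀ c : L, ∃ a b : F, c = algebraMap F L a + algebraMap F L b * D.δ)
    {m : Matrix (Fin 2) (Fin 2) (B ⊗[L] ConjugateAlgebra ι B)} (hm : m ∈ D.rangeAdjoin Q hQ) :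
    ∃ r s, m = D.evenLift Q hQ r + (D.δ : L) • D.evenLift Q hQ s := by
  induction hm using Algebra.adjoin_induction with
  | mem x hx =>
    obtain ⟨r, rfl⟩ := hx
    exact ⟨r, 0, by simp⟩
  | algebraMap c =>
    obtain ⟨a, b, rfl⟩ := hL c
    refine ⟨algebraMap F _ a, algebraMap F _ b, ?_⟩
    rw [AlgHom.commutes, AlgHom.commutes, map_add, map_mul, ← IsScalarTower.algebraMap_apply,
      ← IsScalarTower.algebraMap_apply, ← Algebra.commutes, Algebra.smul_def]
  | add x y _ _ hx hy =>
    obtain ⟨r, s, rfl⟩ := hx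
    obtain ⟨r', s', rfl⟩ := hy
    refine ⟨r + r', s + s', ?_⟩
    rw [map_add, map_add, smul_add]
    abel
  | mul x y _ _ hx hy =>
    obtain ⟨r, s, rfl⟩ := hx
    obtain ⟨r', s', rfl⟩ := hy
    refine ⟨r * r' + d • (s * s'), r * s' + s * r', ?_⟩
    rw [map_add, map_add, map_smul, ← algebraMap_smul L d, hd]
    simp only [map_mul, add_mul, mul_add, smul_mul_assoc, mul_smul_comm, smul_add, smul_smul]
    abel

/-- Descent: write m = f(r) + δf(s). The entries of m, f(r) and f(s) are fixed by the switch, which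
negates `δ`, so δf(s) equals its own negative and vanishes. -/
theorem evenLift_surjective [Invertible (2 : F)] (d : F) (hd : algebraMap F L d = D.δ * D.δ)
    (hL : ∀ c : L, ∃ a b : F, c = algebraMap F L a + algebraMap F L b * D.δ)
    (h : D.rangeAdjoin Q hQ = ⊤) (m : Matrix (Fin 2) (Fin 2) (B ⊗[L] ConjugateAlgebra ι B))
    (hm : ∀ i j, m i j ∈ normAlgebra ι B D.conj_conj) : ∃ r, D.evenLift Q hQ r = m := by
  obtain ⟨r, s, hrs⟩ := D.exists_of_mem_rangeAdjoin Q hQ d hd hL (h ▸ Algebra.mem_top : m ∈ _)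
  refine ⟨r, ?_⟩
  ext i j
  have h1 : m i j = D.evenLift Q hQ r i j + (D.δ : L) • D.evenLift Q hQ s i j := by
    rw [hrs]; rfl
  have h2 : switch ι B D.conj_conj (m i j) = m i j := hm i j
  have h3 : switch ι B D.conj_conj (D.evenLift Q hQ r i j) = D.evenLift Q hQ r i j :=
    D.evenLift_mem_normAlgebra Q hQ r i j
  have h4 : switch ι B D.conj_conj (D.evenLift Q hQ s i j) = D.evenLift Q hQ s i j :=
    D.evenLift_mem_normAlgebra Q hQ s i j
  have h5 := h2
  rw [h1, map_add, h3, switch_smul, h4, D.conj_δ, neg_smul, add_right_inj, eq_comm] at h5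
  rw [h1, eq_zero_of_eq_neg F h5, add_zero]

theorem pair_mem (v w : V) : D.rowMap v * D.colMap w ∈ D.rangeAdjoin Q hQ := by
  rw [← evenLift_evenPair D Q hQ]
  exact Algebra.subset_adjoin ⟨_, rfl⟩

variable [Invertible (2 : L)]

/-- A bilinear expression in vectors and their conjugates has its components in any submodule which
contains its values. -/
theorem _root_.Submodule.mem_of_skew_combinations {M : Type*} [AddCommGroup M] [Module L M]
    (W : Submodule L M) (δ : Lˣ) {a b c d : M} (h1 : a + b + c + d ∈ W)
    (h2 : (δ : L) • (a - b + c - d) ∈ W) (h3 : (δ : L) • (a - b - c + d) ∈ W)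
    (h4 : (δ : L) • (δ : L) • (a + b - c - d) ∈ W) : a ∈ W ∧ b ∈ W ∧ c ∈ W := by
  rw [Submodule.smul_mem_iff_of_isUnit _ δ.isUnit] at h2 h3 h4
  rw [Submodule.smul_mem_iff_of_isUnit _ δ.isUnit] at h4
  -- Once `δ` is cancelled, the four sign patterns form a Hadamard matrix of size 4, which is
  -- invertible since 4 is a unit.
  have h : ∀ x, (4 : L) • x ∈ W → x ∈ W := fun x hx => by
    rwa [Submodule.smul_mem_iff_of_isUnit] at hx
    rw [show (4 : L) = 2 * 2 by norm_num]
    exact (isUnit_of_invertible (2 : L)).mul (isUnit_of_invertible (2 : L))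
  refine ⟨h a ?_, h b ?_, h c ?_⟩
  · convert add_mem (add_mem h1 h2) (add_mem h3 h4) using 1
    module
  · convert sub_mem (add_mem h1 h4) (add_mem h2 h3) using 1
    module
  · convert sub_mem (add_mem h1 h2) (add_mem h3 h4) using 1
    module

/-- Scaling `v` or `w` by `δ` multiplies each of the four summands of `D.rowMap v * D.colMap w` by
`δ` or `-δ`, according to whether that vector occurs in the left or in the right tensor factor. The
four resulting sign patterns separate the summands. -/
theorem components_mem (v w : V) :
    !![(↑D.l⁻¹ : L) • conjInl ι (D.x v * σ (D.x w)), 0;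
      0, (↑D.l⁻¹ : L) • conjInl ι (σ (D.x v) * D.x w)] ∈ D.rangeAdjoin Q hQ ∧
    !![ι ↑D.l⁻¹ • conjInr ι (D.x v * σ (D.x w)), 0;
      0, ι ↑D.l⁻¹ • conjInr ι (σ (D.x v) * D.x w)] ∈ D.rangeAdjoin Q hQ ∧
    !![0, -(D.δ : L) • (conjInl ι (D.x v) * conjInr ι (D.x w));
      (↑D.δ⁻¹ * (↑D.l⁻¹ * ι ↑D.l⁻¹) : L) • (conjInl ι (σ (D.x v)) * conjInr ι (σ (D.x w))), 0] ∈
        D.rangeAdjoin Q hQ := by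
  refine Submodule.mem_of_skew_combinations (Subalgebra.toSubmodule (D.rangeAdjoin Q hQ)) D.δ
    (d := !![0, (D.δ : L) • (conjInl ι (D.x w) * conjInr ι (D.x v));
      -(↑D.δ⁻¹ * (↑D.l⁻¹ * ι ↑D.l⁻¹) : L) • (conjInl ι (σ (D.x w)) * conjInr ι (σ (D.x v))), 0])
    ?_ ?_ ?_ ?_
  · rw [Subalgebra.mem_toSubmodule]
    convert D.pair_mem Q hQ v w using 1
    rw [rowMap_mul_colMap]
    ext i j
    fin_cases i <;> fin_cases j <;> simp
    all_goals module
  · rw [Subalgebra.mem_toSubmodule]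
    convert D.pair_mem Q hQ ((D.δ : L) • v) w using 1
    rw [rowMap_mul_colMap]
    simp only [map_smul, smul_mul_assoc, mul_smul_comm, conjInr_smul ι D.conj_conj, D.conj_δ]
    ext i j
    fin_cases i <;> fin_cases j <;> simp
    all_goals module
  · rw [Subalgebra.mem_toSubmodule]
    convert D.pair_mem Q hQ v ((D.δ : L) • w) using 1
    rw [rowMap_mul_colMap]
    simp only [map_smul, smul_mul_assoc, mul_smul_comm, conjInr_smul ι D.conj_conj, D.conj_δ]
    ext i j
    fin_cases i <;> fin_cases j <;> simp
    all_goals module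
  · rw [Subalgebra.mem_toSubmodule]
    convert D.pair_mem Q hQ ((D.δ : L) • v) ((D.δ : L) • w) using 1
    rw [rowMap_mul_colMap]
    simp only [map_smul, smul_mul_assoc, mul_smul_comm, conjInr_smul ι D.conj_conj, D.conj_δ]
    ext i j
    fin_cases i <;> fin_cases j <;> simp
    all_goals module

variable (hgen : Algebra.adjoin L {p : B × B | ∃ v w, p = (D.x v * σ (D.x w), σ (D.x v) * D.x w)} =
  ⊤)

include hgen in
-- The two diagonal slots are independent because the pairs in `hgen` generate all of `B × B`, not
-- only a diagonal copy of `B`.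
theorem diag_inl_mem (p : B × B) :
    !![conjInl ι p.1, 0; 0, conjInl ι p.2] ∈ D.rangeAdjoin Q hQ := by
  have h : p ∈ Algebra.adjoin L
      {p : B × B | ∃ v w, p = (D.x v * σ (D.x w), σ (D.x v) * D.x w)} := hgen ▸ Algebra.mem_top
  induction h using Algebra.adjoin_induction with
  | mem p hp =>
    obtain ⟨v, w, rfl⟩ := hp
    convert Subalgebra.smul_mem _ (D.components_mem Q hQ v w).1 (D.l : L) using 1
    ext i j
    fin_cases i <;> fin_cases j <;> simp [smul_smul]
  | algebraMap c =>
    convert Subalgebra.algebraMap_mem (D.rangeAdjoin Q hQ) c using 1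
    ext i j
    fin_cases i <;> fin_cases j <;> simp [Matrix.algebraMap_matrix_apply]
  | add x y _ _ hx hy =>
    convert add_mem hx hy using 1
    ext i j
    fin_cases i <;> fin_cases j <;> simp
  | mul x y _ _ hx hy =>
    convert mul_mem hx hy using 1
    ext i j
    fin_cases i <;> fin_cases j <;> simp

include hgen in
theorem diag_inr_mem (p : B × B) :
    !![conjInr ι p.1, 0; 0, conjInr ι p.2] ∈ D.rangeAdjoin Q hQ := by
  have h : p ∈ Algebra.adjoin L
      {p : B × B | ∃ v w, p = (D.x v * σ (D.x w), σ (D.x v) * D.x w)} := hgen ▸ Algebra.mem_top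
  induction h using Algebra.adjoin_induction with
  | mem p hp =>
    obtain ⟨v, w, rfl⟩ := hp
    convert Subalgebra.smul_mem _ (D.components_mem Q hQ v w).2.1 (ι D.l : L) using 1
    have h : ι (D.l : L) * ι ↑D.l⁻¹ = 1 := by rw [mul_comm, D.ι_inv_mul]
    ext i j
    fin_cases i <;> fin_cases j <;> simp [smul_smul, h]
  | algebraMap c =>
    convert Subalgebra.algebraMap_mem (D.rangeAdjoin Q hQ) (ι c) using 1
    have h := conjInr_smul ι D.conj_conj c (1 : B)
    ext i j
    fin_cases i <;> fin_cases j <;>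
      simp [Matrix.algebraMap_matrix_apply, Algebra.algebraMap_eq_smul_one, h]
  | add x y _ _ hx hy =>
    convert add_mem hx hy using 1
    ext i j
    fin_cases i <;> fin_cases j <;> simp
  | mul x y _ _ hx hy =>
    convert mul_mem hx hy using 1
    ext i j
    fin_cases i <;> fin_cases j <;> simp

include hgen in
theorem diag_mem (s t : B ⊗[L] ConjugateAlgebra ι B) : !![s, 0; 0, t] ∈ D.rangeAdjoin Q hQ := by
  have h1 : ∀ s : B ⊗[L] ConjugateAlgebra ι B, !![s, 0; 0, 0] ∈ D.rangeAdjoin Q hQ := by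
    intro s
    induction s using conjTensor_induction with
    | h0 =>
      convert zero_mem (D.rangeAdjoin Q hQ) using 1
      ext i j
      fin_cases i <;> fin_cases j <;> simp
    | h1 a b =>
      convert mul_mem (D.diag_inl_mem Q hQ hgen (a, 0)) (D.diag_inr_mem Q hQ hgen (b, 0)) using 1
      ext i j
      fin_cases i <;> fin_cases j <;> simp
    | h2 s t hs ht =>
      convert add_mem hs ht using 1
      ext i j
      fin_cases i <;> fin_cases j <;> simp
  have h2 : ∀ s : B ⊗[L] ConjugateAlgebra ι B, !![0, 0; 0, s] ∈ D.rangeAdjoin Q hQ := by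
    intro s
    induction s using conjTensor_induction with
    | h0 =>
      convert zero_mem (D.rangeAdjoin Q hQ) using 1
      ext i j
      fin_cases i <;> fin_cases j <;> simp
    | h1 a b =>
      convert mul_mem (D.diag_inl_mem Q hQ hgen (0, a)) (D.diag_inr_mem Q hQ hgen (0, b)) using 1
      ext i j
      fin_cases i <;> fin_cases j <;> simp
    | h2 s t hs ht =>
      convert add_mem hs ht using 1
      ext i j
      fin_cases i <;> fin_cases j <;> simp
  convert add_mem (h1 s) (h2 t) using 1
  ext i j
  fin_cases i <;> fin_cases j <;> simp

include hgen in
-- Diagonal matrices are available by `diag_mem`. At a vector with invertible image the third matrix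
-- of `components_mem` is antidiagonal with unit entries, and its products with diagonal matrices
-- give every antidiagonal matrix.
theorem rangeAdjoin_eq_top (v : V) (hv : IsUnit (D.x v)) (hv' : IsUnit (σ (D.x v))) :
    D.rangeAdjoin Q hQ = ⊤ := by
  rw [eq_top_iff]
  rintro m -
  have h1 : ∀ (u : L) (a : B), IsUnit u → IsUnit a → IsUnit (u • (conjInl ι a * conjInr ι a)) :=
    fun u a hu ha => by
      rw [Algebra.smul_def]
      exact (hu.map _).mul ((ha.map _).mul (ha.map _))
  obtain ⟨a, ha⟩ := h1 (-(D.δ : L)) _ D.δ.isUnit.neg hv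
  obtain ⟨b, hb⟩ := h1 (↑D.δ⁻¹ * (↑D.l⁻¹ * ι ↑D.l⁻¹)) _
    ((Units.isUnit _).mul ((Units.isUnit _).mul ((Units.isUnit _).map ι))) hv'
  have h2 := (D.components_mem Q hQ v v).2.2
  rw [← ha, ← hb] at h2
  have h3 := mul_mem h2 (D.diag_mem Q hQ hgen (↑b⁻¹ * m 1 0) (↑a⁻¹ * m 0 1))
  convert add_mem (D.diag_mem Q hQ hgen (m 0 0) (m 1 1)) h3 using 1
  ext i j
  fin_cases i <;> fin_cases j <;> simp

end SimilitudeData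

end Surjectivity

/-- Algebras with involution which embed with the same image are isomorphic. -/
theorem isoWithInvolution_of_range_eq {R X Y A : Type*} [CommRing R] [Ring X] [Ring Y] [Ring A]
    [Algebra R X] [Algebra R Y] [Algebra R A] {σ : X →ₗ[R] X} {τ : Y →ₗ[R] Y} (ρ : A → A)
    (f : X →ₐ[R] A) (g : Y →ₐ[R] A) (hf : Function.Injective f) (hg : Function.Injective g)
    (h : f.range = g.range) (hfσ : ∀ x, f (σ x) = ρ (f x)) (hgτ : ∀ y, g (τ y) = ρ (g y)) :
    IsoWithInvolution R σ τ := by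
  let e : X ≃ₐ[R] Y := (AlgEquiv.ofInjective f hf).trans
    ((Subalgebra.equivOfEq _ _ h).trans (AlgEquiv.ofInjective g hg).symm)
  have he : ∀ x, g (e x) = f x := fun x => by
    have : AlgEquiv.ofInjective g hg (e x) = Subalgebra.equivOfEq _ _ h
      (AlgEquiv.ofInjective f hf x) := by simp [e]
    exact congrArg Subtype.val this
  refine ⟨e, fun x => hg ?_⟩
  rw [he, hfσ, hgτ, he]

/-! ### The algebra `Ad ⊗ N` as an algebra of matrices -/

section PfisterTensor

variable {F T : Type*} [Field F] [Ring T] [Algebra F T] (N : Subalgebra F T)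

/-- The algebra `End(F²) ⊗ N` is the algebra of `2`-by-`2` matrices over `N`. -/
def endTensorEquiv : Module.End F (Fin 2 → F) ⊗[F] N ≃ₐ[F] Matrix (Fin 2) (Fin 2) N :=
  ((Algebra.TensorProduct.congr LinearMap.toMatrixAlgEquiv' AlgEquiv.refl).trans
    (Algebra.TensorProduct.comm F _ _)).trans (matrixEquivTensor (Fin 2) F N).symm

/-- The embedding of `End(F²) ⊗ N` in the matrix algebra over `T`, for a subalgebra `N` of `T`. -/
def endTensorToMatrix :
    Module.End F (Fin 2 → F) ⊗[F] N →ₐ[F] Matrix (Fin 2) (Fin 2) T :=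
  N.val.mapMatrix.comp (endTensorEquiv N).toAlgHom

theorem endTensorToMatrix_tmul (f : Module.End F (Fin 2 → F)) (n : N) (i j : Fin 2) :
    endTensorToMatrix N (f ⊗ₜ n) i j = LinearMap.toMatrix' f i j • (n : T) := by
  change N.val ((matrixEquivTensor (Fin 2) F N).symm (n ⊗ₜ LinearMap.toMatrix' f) i j) = _
  rw [matrixEquivTensor_apply_symm, Matrix.smul_apply, Matrix.map_apply, smul_eq_mul,
    ← Algebra.commutes, ← Algebra.smul_def]
  rfl

theorem endTensorToMatrix_injective : Function.Injective (endTensorToMatrix N) := by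
  have h : Function.Injective (N.val.mapMatrix : Matrix (Fin 2) (Fin 2) N →ₐ[F] _) :=
    fun m m' h => Matrix.map_injective Subtype.val_injective h
  exact h.comp (endTensorEquiv N).injective

theorem mem_range_endTensorToMatrix (m : Matrix (Fin 2) (Fin 2) T) :
    m ∈ (endTensorToMatrix N).range ↔ ∀ i j, m i j ∈ N := by
  constructor
  · rintro ⟨t, rfl⟩ i j
    exact Subtype.prop (endTensorEquiv N t i j)
  · intro h
    obtain ⟨t, ht⟩ := (endTensorEquiv N).surjective (Matrix.of fun i j => ⟨m i j, h i j⟩)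
    refine ⟨t, ?_⟩
    have : endTensorToMatrix N t = N.val.mapMatrix (Matrix.of fun i j => ⟨m i j, h i j⟩) := by
      rw [← ht]; rfl
    exact this

theorem associated_pfister [Invertible (2 : F)] (c : Fˣ) (x y : Fin 2 → F) :
    QuadraticMap.associated (pfister c) x y = x 0 * y 0 - c * (x 1 * y 1) := by
  have h := congrArg (fun B => B x y) (QuadraticMap.two_nsmul_associated F (pfister c))
  simp only [LinearMap.smul_apply, QuadraticMap.polarBilin_apply_apply,
    QuadraticMap.polar, pfister, QuadraticMap.weightedSumSquares_apply, Fin.sum_univ_two,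
    Pi.add_apply, Matrix.cons_val_zero, Matrix.cons_val_one, smul_eq_mul, nsmul_eq_mul,
    Nat.cast_ofNat] at h
  apply mul_left_cancel₀ (Invertible.ne_zero (2 : F))
  refine Eq.trans h ?_
  ring

/-- Since ⟨⟨-c⟩⟩ = ⟨1, c⟩, evaluating the adjoint relation at basis vectors gives the scalars of
`diagInvolution ![1, c]`. -/
theorem toMatrix_adPfister [Invertible (2 : F)] (c : Fˣ) (f : Module.End F (Fin 2 → F))
    (i j : Fin 2) : LinearMap.toMatrix' (adPfister (-c) f) i j =
      (↑((![1, c] : Fin 2 → Fˣ) i)⁻¹ * ((![1, c] : Fin 2 → Fˣ) j : F)) *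
        LinearMap.toMatrix' f j i := by
  have h := adInvolution_apply (QuadraticMap.associated (pfister (-c)))
    (pfister_nondegenerate (-c)) f (Pi.single j 1) (Pi.single i 1)
  rw [associated_pfister, associated_pfister] at h
  change adPfister (-c) f _ 0 * _ - _ * (adPfister (-c) f _ 1 * _) = _ at h
  rw [LinearMap.toMatrix'_apply, LinearMap.toMatrix'_apply]
  fin_cases i <;> fin_cases j <;> simp_all
  rw [← h, inv_mul_cancel_left₀ c.ne_zero]

theorem endTensorToMatrix_tensorInvolution [Invertible (2 : F)] (c : Fˣ) (τ : T →ₗ[F] T)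
    (τ' : N →ₗ[F] N) (hτ : ∀ n, (τ' n : T) = τ n) (t : Module.End F (Fin 2 → F) ⊗[F] N) :
    endTensorToMatrix N (tensorInvolution (adPfister (-c)) τ' t) =
      diagInvolution ![1, c] τ (endTensorToMatrix N t) := by
  induction t with
  | zero => simp
  | add s t hs ht => simp only [map_add, hs, ht]
  | tmul f n =>
    ext i j
    change endTensorToMatrix N (adPfister (-c) f ⊗ₜ τ' n) i j = _
    rw [diagInvolution_apply, endTensorToMatrix_tmul, endTensorToMatrix_tmul, toMatrix_adPfister,
      map_smul, hτ, smul_smul]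

end PfisterTensor

/-! ### Homomorphisms that map `z` to 1 -/

section Injectivity

variable {F V A : Type*} [Field F] [Invertible (2 : F)] [AddCommGroup V] [Module F V]
  {Q : QuadraticForm F V} [Ring A] [Algebra F A]

namespace CliffordOrientation

variable (p : CliffordOrientation Q)

theorem idem_mul_z {R M : Type*} [CommRing R] [AddCommGroup M] [Module R M]
    {Q : QuadraticForm R M} [Invertible (2 : R)] (o : CliffordOrientation Q) :
    o.idem * o.z = o.idem := by
  rw [idem, smul_mul_assoc, add_mul, o.sq_eq_one, one_mul, add_comm]

/-- The average of xy has the form r + sz and still lies in the kernel of f, so r + s = 0. As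
`p.idem * p.z = p.idem`, multiplying by the idempotent gives (r + s) times it, that is 0; this holds
for all y, and the averages detect nonzero elements. -/
theorem idem_mul_eq_zero [Nontrivial A] (hV : Module.finrank F V ≠ 0) (f : CliffordAlgebra.even Q →ₐ[F] A)
    (hf : f p.z = 1) {x : CliffordAlgebra.even Q} (hx : f x = 0) : p.idem * x = 0 := by
  obtain ⟨us, h1, h2⟩ := p.exists_conjAverage hV
  apply h2
  intro y
  rw [mul_assoc, p.idem_comm, conjAverage_mul_of_commute F (y := p.idem) fun u _ =>
    (p.idem_comm (u : CliffordAlgebra.even Q)).symm]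
  obtain ⟨r, s, h⟩ := h1 (x * y)
  have h3 : f (conjAverage F us (x * y)) = 0 := by
    rw [map_conjAverage, map_mul, hx, zero_mul, map_zero]
  rw [h, map_add, map_smul, map_smul, hf, map_one, ← add_smul,
    ← Algebra.algebraMap_eq_smul_one] at h3
  have h4 : r + s = 0 := (map_eq_zero_iff _ (algebraMap F A).injective).mp h3
  rw [h, add_mul, smul_mul_assoc, smul_mul_assoc, one_mul, p.z_comm, idem_mul_z, ← add_smul, h4,
    zero_smul]

/-- A homomorphism which maps `z` to `1` induces a homomorphism of the component. -/
def componentLift (f : CliffordAlgebra.even Q →ₐ[F] A) (hf : f p.z = 1) : p.Component →ₐ[F] A :=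
  AlgHom.ofLinearMap
    (f.toLinearMap ∘ₗ
      { toFun := fun x => x.1, map_add' := fun _ _ => rfl, map_smul' := fun _ _ => rfl })
    (by
      change f p.idem = 1
      rw [idem, map_smul, map_add, map_one, hf, invOf_two_smul_add_self])
    (fun x y => map_mul f x.1 y.1)

theorem componentLift_apply (f : CliffordAlgebra.even Q →ₐ[F] A) (hf : f p.z = 1)
    (x : p.Component) : p.componentLift f hf x = f x.1 := rfl

theorem componentLift_toComponent (f : CliffordAlgebra.even Q →ₐ[F] A) (hf : f p.z = 1)
    (x : CliffordAlgebra.even Q) : p.componentLift f hf (p.toComponent x) = f x := by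
  have h : f p.idem = 1 := map_one (p.componentLift f hf)
  rw [componentLift_apply, coe_toComponent, map_mul, h, one_mul]

theorem componentLift_injective [Nontrivial A] (hV : Module.finrank F V ≠ 0)
    (f : CliffordAlgebra.even Q →ₐ[F] A) (hf : f p.z = 1) :
    Function.Injective (p.componentLift f hf) := by
  rw [injective_iff_map_eq_zero]
  intro x hx
  have := p.idem_mul_eq_zero hV f hf hx
  rw [← coe_toComponent] at this
  rw [← p.toComponent_coe x]
  exact Subtype.ext this

theorem range_componentLift (f : CliffordAlgebra.even Q →ₐ[F] A) (hf : f p.z = 1) :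
    (p.componentLift f hf).range = f.range := by
  ext a
  constructor
  · rintro ⟨x, rfl⟩
    exact ⟨x.1, rfl⟩
  · rintro ⟨x, rfl⟩
    exact ⟨p.toComponent x, p.componentLift_toComponent f hf x⟩

end CliffordOrientation

end Injectivity

/-! ### The components of the transfer -/

section Transfer

variable {F L B V : Type*} [Field F] [Invertible (2 : F)] [CommRing L]
  [Algebra F L] [Ring B] [Algebra L B]
  [AddCommGroup V] [Module L V] [Algebra F B] [IsScalarTower F L B] [Module F V]
  [IsScalarTower F L V]

namespace SimilitudeData

variable {ι : L →ₐ[F] L} {ψ : QuadraticForm L V} {σ : B →ₗ[L] B} (D : SimilitudeData ι ψ σ)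
  (Q : QuadraticForm F V) (hQ : ∀ v, algebraMap F L (Q v) = ψ v + ι (ψ v))

/-- The image of `z` is central, because the range of f generates the whole matrix algebra over L.
It is thus a scalar matrix given by an element of L, which may be taken in F because of invariance
under the switch, and its square is 1. -/
theorem evenLift_z [Invertible (2 : L)] [Nontrivial (B ⊗[L] ConjugateAlgebra ι B)]
    (p : CliffordOrientation Q)
    (hL : ∀ c : L, ∃ a b : F, c = algebraMap F L a + algebraMap F L b * D.δ)
    (htop : D.rangeAdjoin Q hQ = ⊤) (us : List Bˣ)
    (hus : ∀ b, ∃ c : L, conjAverage L us b = c • 1) :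
    D.evenLift Q hQ p.z = 1 ∨ D.evenLift Q hQ p.z = -1 := by
  have hc : D.evenLift Q hQ p.z ∈
      Set.center (Matrix (Fin 2) (Fin 2) (B ⊗[L] ConjugateAlgebra ι B)) := by
    rw [Semigroup.mem_center_iff]
    intro m
    have hm : m ∈ D.rangeAdjoin Q hQ := htop ▸ Algebra.mem_top
    induction hm using Algebra.adjoin_induction with
    | mem x hx =>
      obtain ⟨r, rfl⟩ := hx
      rw [← map_mul, ← map_mul, p.z_comm]
    | algebraMap c => exact Algebra.commutes _ _
    | add x y _ _ hx hy => rw [add_mul, mul_add, hx, hy]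
    | mul x y _ _ hx hy => rw [mul_assoc, hy, ← mul_assoc, hx, mul_assoc]
  rw [Matrix.center_eq_scalar_image] at hc
  obtain ⟨t, ht, hz⟩ := hc
  obtain ⟨c, rfl⟩ := exists_eq_smul_one_of_commute ι D.conj_conj us hus t
    fun s => (Semigroup.mem_center_iff.mp ht) s
  obtain ⟨a, b, rfl⟩ := hL c
  have h1 : switch ι B D.conj_conj ((algebraMap F L a + algebraMap F L b * D.δ) • 1) =
      (algebraMap F L a + algebraMap F L b * D.δ) • 1 := by
    have := D.evenLift_mem_normAlgebra Q hQ p.z 0 0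
    rw [← hz] at this
    have h : switch ι B D.conj_conj (Matrix.scalar (Fin 2)
        ((algebraMap F L a + algebraMap F L b * D.δ : L) • 1) 0 0) = _ := this
    simpa using h
  have h2 : (algebraMap F L b * D.δ : L) • (1 : B ⊗[L] ConjugateAlgebra ι B) = 0 := by
    apply eq_zero_of_eq_neg F
    rw [switch_smul, switch_one, map_add, map_mul, ι.commutes, ι.commutes, D.conj_δ, mul_neg,
      add_smul, add_smul, neg_smul, add_right_inj] at h1
    exact h1.symm
  rw [add_smul, h2, add_zero, algebraMap_smul] at hz
  have h3 : D.evenLift Q hQ p.z = algebraMap F _ a := by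
    rw [← hz]
    ext i j
    simp [Matrix.algebraMap_matrix_apply, Matrix.diagonal_apply, Algebra.algebraMap_eq_smul_one]
  have h4 : a * a = 1 := by
    apply (algebraMap F (Matrix (Fin 2) (Fin 2) (B ⊗[L] ConjugateAlgebra ι B))).injective
    rw [map_mul, ← h3, ← map_mul, p.sq_eq_one, map_one, map_one]
  rcases mul_self_eq_one_iff.mp h4 with rfl | rfl
  · left; rw [h3, map_one]
  · right; rw [h3, map_neg, map_one]

/-- If the image of `z` is `1`, then the corresponding component of the even Clifford algebra of the
transfer is the tensor product of a split quaternion algebra and a norm. -/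
theorem isoWithInvolution_of_evenLift_z [Nontrivial (B ⊗[L] ConjugateAlgebra ι B)]
    (p : CliffordOrientation Q) (hV : Module.finrank F V ≠ 0)
    (hL : ∀ c : L, ∃ a b : F, c = algebraMap F L a + algebraMap F L b * D.δ)
    (htop : D.rangeAdjoin Q hQ = ⊤) (d n : Fˣ) (hd : algebraMap F L d = D.δ * D.δ)
    (hn : algebraMap F L n = D.l * ι D.l) (hz : D.evenLift Q hQ p.z = 1) :
    IsoWithInvolution F p.componentInvolution
      (tensorInvolution (adPfister (-d * n)) (normInvolution ι D.conj_conj σ)) := by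
  refine isoWithInvolution_of_range_eq (diagInvolution ![1, d * n]
      ((TensorProduct.map σ (conjugateMap ι σ)).restrictScalars F))
    (p.componentLift (D.evenLift Q hQ) hz) (endTensorToMatrix (normAlgebra ι B D.conj_conj))
    (p.componentLift_injective hV _ hz) (endTensorToMatrix_injective _) ?_ (fun x => ?_)
    (fun y => ?_)
  · rw [p.range_componentLift]
    ext m
    rw [mem_range_endTensorToMatrix]
    constructor
    · rintro ⟨x, rfl⟩
      exact D.evenLift_mem_normAlgebra Q hQ x
    · exact D.evenLift_surjective Q hQ d hd hL htop m
  · exact D.evenLift_evenInvolution Q hQ _ (by rw [Units.val_mul, map_mul, hd, hn]) x.1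
  · rw [neg_mul]
    exact endTensorToMatrix_tensorInvolution _ _ _ _ (fun _ => rfl) y

/-- Both components of the even Clifford algebra of the transfer. -/
theorem isoWithInvolution_components [Invertible (2 : L)]
    [Nontrivial (B ⊗[L] ConjugateAlgebra ι B)]
    (p : CliffordOrientation Q) (hV : Module.finrank F V ≠ 0)
    (hL : ∀ c : L, ∃ a b : F, c = algebraMap F L a + algebraMap F L b * D.δ)
    (htop : D.rangeAdjoin Q hQ = ⊤) (d n : Fˣ) (hd : algebraMap F L d = D.δ * D.δ)
    (hn : algebraMap F L n = D.l * ι D.l) (us : List Bˣ)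
    (hus : ∀ b, ∃ c : L, conjAverage L us b = c • 1) :
    IsoWithInvolution F p.componentInvolution
      (tensorInvolution (adPfister (-d * n)) (normInvolution ι D.conj_conj σ)) ∧
    IsoWithInvolution F p.neg.componentInvolution
      (tensorInvolution (adPfister (-d * n)) (normInvolution ι D.conj_conj σ)) := by
  have hs : ∃ u : Fˣ, ∃ v, Q v = u := by
    obtain ⟨b, -, -, -, -, h⟩ := p.exists_basis_isUnit
    obtain ⟨u, hu⟩ := h ⟨0, Nat.pos_of_ne_zero hV⟩
    exact ⟨u, _, hu.symm⟩
  obtain ⟨u, v, hv⟩ := hs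
  obtain ⟨e, he⟩ := p.isoWithInvolution_neg v u hv
  -- The sign tells which component f describes; the other one follows through `e`.
  rcases D.evenLift_z Q hQ p hL htop us hus with hz | hz
  · obtain ⟨f, hf⟩ := D.isoWithInvolution_of_evenLift_z Q hQ p hV hL htop d n hd hn hz
    refine ⟨⟨f, hf⟩, e.symm.trans f, fun x => ?_⟩
    obtain ⟨x, rfl⟩ := e.surjective x
    simp [← he, hf]
  · have hz' : D.evenLift Q hQ p.neg.z = 1 := by
      rw [show p.neg.z = -p.z from rfl, map_neg, hz, neg_neg]
    obtain ⟨f, hf⟩ := D.isoWithInvolution_of_evenLift_z Q hQ p.neg hV hL htop d n hd hn hz'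
    refine ⟨⟨e.trans f, fun x => ?_⟩, f, hf⟩
    simp [he, hf]

end SimilitudeData

end Transfer

/-! ### The similitude `w ↦ w v₀` into a component -/

section Concrete

variable {F L V : Type*} [Field F] [CommRing L] [Invertible (2 : L)]
  [Algebra F L] [AddCommGroup V] [Module L V] {ψ : QuadraticForm L V}

omit [Invertible (2 : L)] in
theorem evenPair_self (v : V) : evenPair ψ v v = algebraMap L _ (ψ v) :=
  (CliffordAlgebra.even.ι ψ).contract v

namespace CliffordOrientation

variable (o : CliffordOrientation ψ) (v₀ : V) (l : Lˣ) (h₀ : ψ v₀ = l)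

/-- The linear map `w ↦ w v₀`, from vectors to a component of the even Clifford algebra. -/
def vectorMap : V →ₗ[L] o.Component :=
  o.toComponent.toLinearMap ∘ₗ (CliffordAlgebra.even.ι ψ).bilin.flip v₀

theorem vectorMap_apply (w : V) : o.vectorMap v₀ w = o.toComponent (evenPair ψ w v₀) := rfl

theorem componentInvolution_vectorMap (w : V) :
    o.componentInvolution (o.vectorMap v₀ w) = o.toComponent (evenPair ψ v₀ w) := by
  rw [vectorMap_apply, componentInvolution_toComponent]
  congr 1
  exact Subtype.ext (by simp [coe_evenPair])

include h₀ in
theorem vectorMap_mul (v w : V) : o.vectorMap v₀ v * o.componentInvolution (o.vectorMap v₀ w) =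
    (l : L) • o.toComponent (evenPair ψ v w) := by
  rw [componentInvolution_vectorMap, vectorMap_apply, ← map_mul,
    (CliffordAlgebra.even.ι ψ).contract_mid, map_smul, h₀]

include h₀ in
-- In contrast to `vectorMap_mul`, the outer factors `v₀` remain and conjugate the pair; this
-- records the second component of C₀(ψ) inside the first.
theorem mul_vectorMap (v w : V) : o.componentInvolution (o.vectorMap v₀ v) * o.vectorMap v₀ w =
    (l : L) • o.toComponent (vectorConj v₀ l h₀ (evenPair ψ v w)) := by
  rw [componentInvolution_vectorMap, vectorMap_apply, ← map_mul, ← map_smul]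
  congr 1
  apply Subtype.ext
  change CliffordAlgebra.ι ψ v₀ * CliffordAlgebra.ι ψ v *
    (CliffordAlgebra.ι ψ w * CliffordAlgebra.ι ψ v₀) = (l : L) • ((↑l⁻¹ : L) •
    (CliffordAlgebra.ι ψ v₀ * (CliffordAlgebra.ι ψ v * CliffordAlgebra.ι ψ w) *
      CliffordAlgebra.ι ψ v₀))
  rw [smul_smul, Units.mul_inv, one_smul]
  simp only [mul_assoc]

include h₀ in
/-- The two components are generated by products of two vectors. -/
theorem adjoin_vectorMap_eq_top : Algebra.adjoin L {p : o.Component × o.Component | ∃ v w,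
    p = (o.vectorMap v₀ v * o.componentInvolution (o.vectorMap v₀ w),
      o.componentInvolution (o.vectorMap v₀ v) * o.vectorMap v₀ w)} = ⊤ := by
  rw [eq_top_iff]
  rintro ⟨x, y⟩ -
  -- The map a ↦ (a, v₀av₀⁻¹), projected to the component, sends each product vw to l⁻¹ times a
  -- generator; it remains to see that it is onto.
  let κ : CliffordAlgebra.even ψ →ₐ[L] o.Component × o.Component :=
    o.toComponent.prod (o.toComponent.comp (vectorConj v₀ l h₀))
  have h1 : ∀ a, κ a ∈ Algebra.adjoin L {p : o.Component × o.Component | ∃ v w,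
      p = (o.vectorMap v₀ v * o.componentInvolution (o.vectorMap v₀ w),
        o.componentInvolution (o.vectorMap v₀ v) * o.vectorMap v₀ w)} := by
    intro a
    induction a using even_induction_pair with
    | h0 r =>
      rw [AlgHom.commutes]
      exact Subalgebra.algebraMap_mem _ r
    | h1 x y hx hy => rw [map_add]; exact add_mem hx hy
    | h2 v w x hx =>
      rw [map_mul]
      refine mul_mem ?_ hx
      have h2 : κ (evenPair ψ v w) = (↑l⁻¹ : L) •
          (o.vectorMap v₀ v * o.componentInvolution (o.vectorMap v₀ w),
          o.componentInvolution (o.vectorMap v₀ v) * o.vectorMap v₀ w) := by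
        rw [o.vectorMap_mul v₀ l h₀, o.mul_vectorMap v₀ l h₀, ← Prod.smul_mk, smul_smul,
          Units.inv_mul, one_smul]
        rfl
      rw [h2]
      refine Subalgebra.smul_mem _ (Algebra.subset_adjoin ?_) _
      exact ⟨v, w, rfl⟩
  -- Conjugation by `v₀` exchanges the idempotents, so each summand survives in exactly one
  -- coordinate.
  have h2 : κ (o.idem * x.1 + o.neg.idem * vectorConj v₀ l h₀ y.1) = (x, y) := by
    have hn : vectorConj v₀ l h₀ o.neg.idem = o.idem := by
      rw [← o.vectorConj_idem v₀ l h₀, vectorConj_vectorConj]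
    refine Prod.ext ?_ ?_
    · change o.toComponent _ = x
      rw [map_add, map_mul, map_mul, toComponent_idem, toComponent_neg_idem, toComponent_coe,
        one_mul, zero_mul, add_zero]
    · change o.toComponent (vectorConj v₀ l h₀ _) = y
      rw [map_add, map_mul, map_mul, vectorConj_idem, hn, vectorConj_vectorConj, map_add, map_mul,
        map_mul, toComponent_idem, toComponent_neg_idem, toComponent_coe, one_mul, zero_mul,
        zero_add]
  rw [← h2]
  exact h1 _

/-- The linear map `w ↦ w v₀` is a similitude. -/
def similitudeData (ι : L →ₐ[F] L) (hι : ∀ c, ι (ι c) = c) (δ : Lˣ) (hδ : ι δ = -δ) :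
    SimilitudeData ι ψ o.componentInvolution where
  x := o.vectorMap v₀
  l := l
  δ := δ
  conj_conj := hι
  conj_δ := hδ
  σ_mul a b := Subtype.ext (evenInvolution_mul ψ a.1 b.1)
  σ_σ a := Subtype.ext (Subtype.ext (CliffordAlgebra.reverse_reverse _))
  x_mul_σ v := by
    rw [o.vectorMap_mul v₀ l h₀, evenPair_self,
      Algebra.algebraMap_eq_smul_one, map_smul, map_one, smul_smul]
  σ_mul_x v := by
    rw [o.mul_vectorMap v₀ l h₀, evenPair_self,
      Algebra.algebraMap_eq_smul_one, map_smul, map_smul, map_one, map_one, smul_smul]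

/-- In the component `z` becomes 1, so the span of 1 and z collapses to scalars. -/
theorem exists_conjAverage_component (hV : Module.finrank L V ≠ 0) : ∃ us : List o.Componentˣ,
    ∀ b, ∃ c : L, conjAverage L us b = c • 1 := by
  obtain ⟨us, h, -⟩ := o.exists_conjAverage hV
  refine ⟨us.map (Units.map (o.toComponent : CliffordAlgebra.even ψ →* o.Component)), fun b => ?_⟩
  obtain ⟨b, rfl⟩ := o.toComponent_surjective b
  obtain ⟨r, s, hrs⟩ := h b
  refine ⟨r + s, ?_⟩
  rw [← map_conjAverage, hrs, map_add, map_smul, map_smul, map_one, toComponent_z, add_smul]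

include h₀ in
-- A linear form `r` on the component with r(1) = 1 suffices, as `r` tensored with its conjugate
-- then maps 1 to 1. The scalar part of x plus that of its conjugate by `v₀` is such a form, because
-- the two idempotents add up to 1.
theorem nontrivial_tensor [Nontrivial L] (ι : L →ₐ[F] L) (hι : ∀ c, ι (ι c) = c) :
    Nontrivial (o.Component ⊗[L] ConjugateAlgebra ι o.Component) := by
  let r₀ : CliffordAlgebra.even ψ →ₗ[L] L :=
    cliffordScalarPart ψ ∘ₗ (CliffordAlgebra.even ψ).val.toLinearMap
  have hr₀ : r₀ 1 = 1 := by
    have := cliffordScalarPart_algebraMap ψ 1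
    rwa [map_one] at this
  let r : o.Component →ₗ[L] L := (r₀ + r₀ ∘ₗ (vectorConj v₀ l h₀).toLinearMap) ∘ₗ
    { toFun := fun x => x.1, map_add' := fun _ _ => rfl, map_smul' := fun _ _ => rfl }
  have hr : r 1 = 1 := by
    change r₀ o.idem + r₀ (vectorConj v₀ l h₀ o.idem) = 1
    rw [vectorConj_idem, neg_idem, ← map_add, add_sub_cancel, hr₀]
  let r' : ConjugateAlgebra ι o.Component →ₗ[L] L :=
    { toFun := fun x => ι (r ((toConjugate ι _).symm x))
      map_add' := fun x y => by rw [map_add, map_add, map_add]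
      map_smul' := fun c x => by
        obtain ⟨x, rfl⟩ := (toConjugate ι o.Component).surjective x
        rw [smul_toConjugate, RingEquiv.symm_apply_apply, RingEquiv.symm_apply_apply, map_smul,
          smul_eq_mul, map_mul, hι]
        rfl }
  refine nontrivial_of_ne 1 0 fun h => ?_
  have h1 := congrArg (LinearMap.mul' L L ∘ₗ TensorProduct.map r r') h
  rw [map_zero] at h1
  change r 1 * ι (r 1) = 0 at h1
  rw [hr, map_one, one_mul] at h1
  exact one_ne_zero h1

end CliffordOrientation

end Concrete

/-! ### Existence of orientations -/

section Existence

variable {R M : Type*} [CommRing R] [AddCommGroup M] [Module R M]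

/-- An orthogonal basis whose determinant is a square gives an orientation. -/
theorem CliffordOrientation.nonempty_of_basis {Q : QuadraticForm R M}
    (h4 : 4 ∣ Module.finrank R M) (b : Module.Basis (Fin (Module.finrank R M)) R M)
    (hb : ∀ i j, i ≠ j → QuadraticMap.polar Q (b i) (b j) = 0) (w : Rˣ)
    (hw : ∏ i, Q (b i) = (w : R) ^ 2) : Nonempty (CliffordOrientation Q) := by
  have hmem : ((List.finRange (Module.finrank R M)).map fun i => CliffordAlgebra.ι Q (b i)).prod ∈
      CliffordAlgebra.even Q := by
    refine prod_map_ι_mem_even b _ ?_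
    rw [List.length_finRange]
    exact even_iff_two_dvd.mpr (dvd_trans (by norm_num) h4)
  have hsq := prod_map_mul_prod_map_reverse (R := R) (q := fun i => Q (b i))
    (g := fun i => CliffordAlgebra.ι Q (b i)) (fun i => CliffordAlgebra.ι_sq_scalar Q (b i))
    (List.finRange (Module.finrank R M))
  have hp : (List.ofFn b).Pairwise fun x y => QuadraticMap.polar Q x y = 0 := by
    rw [List.pairwise_ofFn]
    exact fun i j hij => hb i j hij.ne
  have hrev := reverse_prod_of_orthogonal Q _ hp
  have he : Even ((Module.finrank R M).choose 2) := by
    obtain ⟨k, hk⟩ := h4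
    rw [hk, Nat.choose_two_right]
    refine ⟨k * (4 * k - 1), ?_⟩
    have : 4 * k * (4 * k - 1) = 2 * (k * (4 * k - 1) + k * (4 * k - 1)) := by ring
    rw [this, Nat.mul_div_cancel_left _ (by norm_num)]
  rw [List.length_ofFn, he.neg_one_pow, one_smul, CliffordAlgebra.reverse_prod_map_ι,
    List.ofFn_eq_map, List.map_map, ← List.map_reverse] at hrev
  rw [show (fun i => CliffordAlgebra.ι Q (b i)) = CliffordAlgebra.ι Q ∘ b from rfl, hrev,
    ← Fin.prod_univ_def, hw] at hsq
  -- Reversal fixes the product of the basis because n(n-1)/2 is even, so its square is ∏ Q(b i) =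
  -- w².
  refine ⟨⟨(↑w⁻¹ : R) • ⟨_, hmem⟩, h4, Subtype.ext ?_, b, ↑w⁻¹, hb, ?_⟩⟩
  · change ((↑w⁻¹ : R) • _) * ((↑w⁻¹ : R) • _) = (1 : CliffordAlgebra Q)
    refine (smul_mul_smul_comm _ _ _ _).trans ?_
    refine (congrArg _ hsq).trans ?_
    rw [Algebra.smul_def, ← map_mul, ← map_one (algebraMap R (CliffordAlgebra Q))]
    congr 1
    rw [sq, mul_mul_mul_comm, Units.inv_mul, one_mul]
  · rw [List.ofFn_eq_map]
    rfl

/-- Every symmetric matrix is congruent to a diagonal matrix. -/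
def SymmetricDiagonalizable (R : Type*) [CommRing R] : Prop :=
  ∀ (n : ℕ) (G : Matrix (Fin n) (Fin n) R), G.IsSymm →
    ∃ P P' : Matrix (Fin n) (Fin n) R, P * P' = 1 ∧ (P.transpose * G * P).IsDiag

theorem symmetricDiagonalizable_field (K : Type*) [Field K] [Invertible (2 : K)] :
    SymmetricDiagonalizable K := by
  intro n G hG
  have hB : LinearMap.IsSymm (Matrix.toBilin' G) :=
    LinearMap.BilinForm.isSymm_iff.mp (Matrix.isSymm_toBilin'_iff_isSymm.mpr hG)
  obtain ⟨v, hv⟩ := LinearMap.BilinForm.exists_orthogonal_basis hB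
  let b := v.reindex (finCongr (Module.finrank_fin_fun K))
  refine ⟨(Pi.basisFun K (Fin n)).toMatrix b, b.toMatrix (Pi.basisFun K (Fin n)),
    Module.Basis.toMatrix_mul_toMatrix_flip _ _, ?_⟩
  have h := LinearMap.BilinForm.toMatrix_mul_basis_toMatrix (Pi.basisFun K (Fin n)) b
    (Matrix.toBilin' G)
  rw [LinearMap.BilinForm.toMatrix_basisFun, LinearMap.BilinForm.toMatrix'_toBilin'] at h
  rw [h]
  intro i j hij
  rw [LinearMap.BilinForm.toMatrix_apply]
  simp only [b, Module.Basis.reindex_apply]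
  exact hv (fun h => hij ((finCongr (Module.finrank_fin_fun K)).symm.injective h))

theorem SymmetricDiagonalizable.pi {I : Type*} {R : I → Type*} [∀ i, CommRing (R i)]
    (h : ∀ i, SymmetricDiagonalizable (R i)) : SymmetricDiagonalizable (∀ i, R i) := by
  intro n G hG
  choose P P' h1 h2 using fun i => h i n (G.map fun r => r i) (hG.map _)
  refine ⟨.of fun a b i => P i a b, .of fun a b i => P' i a b, ?_, fun a b hab => ?_⟩
  · ext a b i
    have := congrFun (congrFun (h1 i) a) b
    rw [Matrix.mul_apply] at this
    rw [Matrix.mul_apply, Finset.sum_apply]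
    refine this.trans ?_
    rw [Matrix.one_apply, Matrix.one_apply]
    split_ifs <;> rfl
  · ext i
    have := h2 i hab
    simpa only [Matrix.mul_apply, Finset.sum_apply, Pi.mul_apply, Matrix.transpose_apply,
      Matrix.map_apply, Matrix.of_apply, Pi.zero_apply] using this

theorem SymmetricDiagonalizable.of_ringEquiv {R S : Type*} [CommRing R] [CommRing S] (e : R ≃+* S)
    (h : SymmetricDiagonalizable S) : SymmetricDiagonalizable R := by
  intro n G hG
  obtain ⟨P, P', h1, h2⟩ := h n (G.map e) (hG.map _)
  refine ⟨P.map e.symm, P'.map e.symm, ?_, fun i j hij => ?_⟩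
  · rw [← Matrix.map_mul, h1, Matrix.map_one _ (map_zero _) (map_one _)]
  · have h3 : G = (G.map e).map e.symm := by ext; simp
    have h4 : (P.map e.symm).transpose * G * P.map e.symm =
        (P.transpose * G.map e * P).map e.symm := by
      conv_lhs => rw [h3, ← Matrix.transpose_map, ← Matrix.map_mul, ← Matrix.map_mul]
    change ((P.map e.symm).transpose * G * P.map e.symm) i j = 0
    rw [h4, Matrix.map_apply]
    refine (congrArg _ (h2 hij)).trans (map_zero _)

/-- A reduced Artinian ring is a finite product of fields, and matrices can be diagonalised in each
factor. This treats the split and the nonsplit L together. -/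
theorem symmetricDiagonalizable_of_isReduced (R : Type*) [CommRing R] [IsArtinianRing R]
    [IsReduced R] [Invertible (2 : R)] : SymmetricDiagonalizable R := by
  refine .of_ringEquiv (IsArtinianRing.equivPi R).toRingEquiv (.pi fun I => ?_)
  let := Ideal.Quotient.field I.asIdeal
  let : Invertible (2 : R ⧸ I.asIdeal) :=
    (Invertible.map (Ideal.Quotient.mk I.asIdeal) (2 : R)).copy _ (map_ofNat _ 2).symm
  exact symmetricDiagonalizable_field (R ⧸ I.asIdeal)

/-- The sign in the discriminant is 1 because 4 divides the rank, and a change of basis `P`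
multiplies the determinant by det(P)²; hence the witness det(P)·u. -/
theorem HasTrivialDiscriminant.exists_basis [Invertible (2 : R)] (hR : SymmetricDiagonalizable R)
    {Q : QuadraticForm R M} (h4 : 4 ∣ Module.finrank R M) (h : HasTrivialDiscriminant Q) :
    ∃ (b : Module.Basis (Fin (Module.finrank R M)) R M) (w : Rˣ),
      (∀ i j, i ≠ j → QuadraticMap.polar Q (b i) (b j) = 0) ∧ ∏ i, Q (b i) = (w : R) ^ 2 := by
  obtain ⟨b, u, hu⟩ := h
  obtain ⟨k, hk⟩ := h4
  have he : Even (Module.finrank R M * (Module.finrank R M - 1) / 2) := by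
    rw [hk]
    refine ⟨k * (4 * k - 1), ?_⟩
    have : 4 * k * (4 * k - 1) = 2 * (k * (4 * k - 1) + k * (4 * k - 1)) := by ring
    rw [this, Nat.mul_div_cancel_left _ (by norm_num)]
  rw [he.neg_one_pow, one_mul] at hu
  obtain ⟨P, P', h1, h2⟩ := hR _ (LinearMap.BilinForm.toMatrix b (QuadraticMap.associated Q)) (by
    ext i j
    simp only [Matrix.transpose_apply, LinearMap.BilinForm.toMatrix_apply]
    exact QuadraticMap.associated_isSymm R Q _ _)
  let b' := b.map (Matrix.toLinOfInv b b h1 (mul_eq_one_comm.mp h1))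
  have hP : b.toMatrix b' = P := by
    ext i j
    simp [b', Module.Basis.toMatrix_apply, Matrix.toLin_self, Finsupp.single_apply]
  have h3 := LinearMap.BilinForm.toMatrix_mul_basis_toMatrix b b' (QuadraticMap.associated Q)
  rw [hP] at h3
  rw [h3] at h2
  have hP1 : IsUnit P.det := (Matrix.isUnit_iff_isUnit_det P).mp
    ⟨⟨P, P', h1, mul_eq_one_comm.mp h1⟩, rfl⟩
  refine ⟨b', hP1.unit * u, fun i j hij => ?_, ?_⟩
  · have : LinearMap.BilinForm.toMatrix b' (QuadraticMap.associated Q) i j = 0 := h2 hij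
    rw [LinearMap.BilinForm.toMatrix_apply] at this
    have h5 := congrArg (fun B => B (b' i) (b' j)) (QuadraticMap.two_nsmul_associated R Q)
    simp only [LinearMap.smul_apply, QuadraticMap.polarBilin_apply_apply] at h5
    rw [← h5, this, smul_zero]
  · have h5 := congrArg Matrix.det h3
    rw [Matrix.det_mul, Matrix.det_mul, Matrix.det_transpose, hu, ← h2.diagonal_diag,
      Matrix.det_diagonal] at h5
    simp only [Matrix.diag_apply, LinearMap.BilinForm.toMatrix_apply,
      QuadraticMap.associated_eq_self_apply] at h5
    rw [← h5, Units.val_mul, IsUnit.unit_spec]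
    ring

end Existence

/-! ### The algebra `F[X]/(X² - d)` and the transfer -/

section QuadraticEtale

open Polynomial

variable {F : Type*} [Field F] (d : Fˣ)

theorem monic_X_sq_sub_C : (X ^ 2 - C (d : F)).Monic := monic_X_pow_sub_C _ two_ne_zero

theorem root_mul_root : AdjoinRoot.root (X ^ 2 - C (d : F)) * AdjoinRoot.root (X ^ 2 - C (d : F)) =
    algebraMap F (QuadraticEtale d) d := by
  have h := AdjoinRoot.eval₂_root (X ^ 2 - C (d : F))
  simp only [eval₂_sub, eval₂_X_pow, eval₂_C] at h
  rw [← sq]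
  exact sub_eq_zero.mp h

/-- The class of `X` in `F[X]/(X² - d)`. -/
def etaleRoot : (QuadraticEtale d)ˣ :=
  have h : AdjoinRoot.root (X ^ 2 - C (d : F)) *
      (AdjoinRoot.root (X ^ 2 - C (d : F)) * algebraMap F (QuadraticEtale d) ↑d⁻¹) = 1 := by
    rw [← mul_assoc, root_mul_root, ← map_mul, Units.mul_inv, map_one]
  ⟨AdjoinRoot.root _, _, h, (mul_comm _ _).trans h⟩

theorem etaleRoot_mul_self :
    (etaleRoot d : QuadraticEtale d) * etaleRoot d = algebraMap F (QuadraticEtale d) d :=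
  root_mul_root d

theorem etaleConj_etaleRoot : etaleConj d (etaleRoot d) = -etaleRoot d := by
  simp [etaleRoot, etaleConj]

/-- The basis `(1, δ)` of `F[X]/(X² - d)`. -/
def etaleBasis : Module.Basis (Fin 2) F (QuadraticEtale d) :=
  (AdjoinRoot.powerBasis' (monic_X_sq_sub_C d)).basis.reindex
    (finCongr ((AdjoinRoot.powerBasis'_dim _).trans (natDegree_X_pow_sub_C)))

@[simp]
theorem etaleBasis_zero : etaleBasis d 0 = 1 := by
  simp [etaleBasis]

@[simp]
theorem etaleBasis_one : etaleBasis d 1 = etaleRoot d := by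
  simp [etaleBasis, etaleRoot]

instance : Module.Finite F (QuadraticEtale d) := (monic_X_sq_sub_C d).finite_adjoinRoot

theorem finrank_quadraticEtale : Module.finrank F (QuadraticEtale d) = 2 := by
  rw [Module.finrank_eq_card_basis (etaleBasis d), Fintype.card_fin]

instance : Nontrivial (QuadraticEtale d) :=
  Module.nontrivial_of_finrank_pos (R := F) (by rw [finrank_quadraticEtale]; norm_num)

instance : IsArtinianRing (QuadraticEtale d) := IsArtinianRing.of_finite F _

theorem exists_eq_add_mul_etaleRoot (x : QuadraticEtale d) : ∃ a b : F,
    x = algebraMap F _ a + algebraMap F _ b * etaleRoot d := by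
  refine ⟨(etaleBasis d).repr x 0, (etaleBasis d).repr x 1, ?_⟩
  have h := (etaleBasis d).sum_repr x
  rw [Fin.sum_univ_two, etaleBasis_zero, etaleBasis_one, Algebra.smul_def, Algebra.smul_def,
    mul_one] at h
  exact h.symm

theorem etaleConj_add_mul (a b : F) :
    etaleConj d (algebraMap F _ a + algebraMap F _ b * etaleRoot d) =
      algebraMap F _ a - algebraMap F _ b * etaleRoot d := by
  rw [map_add, map_mul, AlgHom.commutes, AlgHom.commutes, etaleConj_etaleRoot, mul_neg]
  exact (sub_eq_add_neg _ _).symm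

theorem repr_add_mul (a b : F) :
    (etaleBasis d).repr (algebraMap F _ a + algebraMap F _ b * etaleRoot d) =
      Finsupp.single 0 a + Finsupp.single 1 b := by
  have h : algebraMap F (QuadraticEtale d) a + algebraMap F _ b * etaleRoot d =
      a • etaleBasis d 0 + b • etaleBasis d 1 := by
    rw [etaleBasis_zero, etaleBasis_one, Algebra.smul_def, Algebra.smul_def, mul_one]
  rw [h, map_add, map_smul, map_smul, Module.Basis.repr_self, Module.Basis.repr_self,
    Finsupp.smul_single_one, Finsupp.smul_single_one]

theorem leftMulMatrix_add_mul (a b : F) :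
    Algebra.leftMulMatrix (etaleBasis d) (algebraMap F _ a + algebraMap F _ b * etaleRoot d) =
      !![a, b * d; b, a] := by
  have h : (algebraMap F (QuadraticEtale d) a + algebraMap F _ b * etaleRoot d) * etaleRoot d =
      algebraMap F _ (b * d) + algebraMap F _ a * etaleRoot d := by
    rw [add_mul, mul_assoc, etaleRoot_mul_self, map_mul, add_comm]
  ext i j
  rw [Algebra.leftMulMatrix_eq_repr_mul]
  fin_cases j
  · simp only [Fin.zero_eta, etaleBasis_zero, mul_one, repr_add_mul]
    fin_cases i <;> simp
  · simp only [Fin.mk_one, etaleBasis_one, h, repr_add_mul]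
    fin_cases i <;> simp

theorem algebraMap_trace_quadraticEtale (x : QuadraticEtale d) :
    algebraMap F _ (Algebra.trace F (QuadraticEtale d) x) = x + etaleConj d x := by
  obtain ⟨a, b, rfl⟩ := exists_eq_add_mul_etaleRoot d x
  rw [Algebra.trace_eq_matrix_trace (etaleBasis d), leftMulMatrix_add_mul, etaleConj_add_mul,
    Matrix.trace_fin_two_of, map_add]
  ring

theorem algebraMap_norm_quadraticEtale (x : QuadraticEtale d) :
    algebraMap F _ (Algebra.norm F x) = x * etaleConj d x := by
  obtain ⟨a, b, rfl⟩ := exists_eq_add_mul_etaleRoot d x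
  rw [Algebra.norm_eq_matrix_det (etaleBasis d), leftMulMatrix_add_mul, etaleConj_add_mul,
    Matrix.det_fin_two_of, map_sub, map_mul, map_mul, map_mul, ← etaleRoot_mul_self]
  ring

theorem trace_etaleConj (x : QuadraticEtale d) :
    Algebra.trace F (QuadraticEtale d) (etaleConj d x) = Algebra.trace F _ x := by
  apply (algebraMap F (QuadraticEtale d)).injective
  rw [algebraMap_trace_quadraticEtale, algebraMap_trace_quadraticEtale, etaleConj_etaleConj,
    add_comm]

theorem trace_etaleRoot : Algebra.trace F (QuadraticEtale d) (etaleRoot d) = 0 := by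
  apply (algebraMap F (QuadraticEtale d)).injective
  rw [algebraMap_trace_quadraticEtale, etaleConj_etaleRoot, add_neg_cancel, map_zero]

variable [Invertible (2 : F)]

instance : IsReduced (QuadraticEtale d) := by
  rw [isReduced_iff_pow_one_lt 2 one_lt_two]
  intro x hx
  obtain ⟨a, b, rfl⟩ := exists_eq_add_mul_etaleRoot d x
  have h : algebraMap F (QuadraticEtale d) (a * a + b * b * d) +
      algebraMap F _ (2 * a * b) * etaleRoot d = 0 := by
    rw [← hx, map_add, map_mul, map_mul, map_mul, map_mul, map_mul, ← etaleRoot_mul_self,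
      map_ofNat]
    ring
  have h' := repr_add_mul d (a * a + b * b * d) (2 * a * b)
  rw [h, map_zero] at h'
  have h0 := DFunLike.congr_fun h' 0
  have h1 := DFunLike.congr_fun h' 1
  simp [Invertible.ne_zero (2 : F)] at h0 h1
  rcases h1 with rfl | rfl
  · have : b = 0 := by simpa using h0.symm
    simp [this]
  · have : a = 0 := by simpa using h0.symm
    simp [this]

/-- A form `⟨a⟩` with `a ≠ 0` has a nonzero transfer. -/
theorem exists_trace_mul_sq_ne_zero {a : QuadraticEtale d} (ha : a ≠ 0) :
    ∃ c, Algebra.trace F (QuadraticEtale d) (a * c ^ 2) ≠ 0 := by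
  by_contra! h
  have h1 := h 1
  -- As (1 + δ)² = 1 + d + 2δ, the test elements 1 and 1 + δ give tr(a) = tr(aδ) = 0, which kills
  -- both coordinates of `a`.
  have h2 := h (1 + etaleRoot d)
  have h3 : a * (1 + etaleRoot d : QuadraticEtale d) ^ 2 =
      (1 + (d : F)) • a + (2 : F) • (a * etaleRoot d) := by
    rw [Algebra.smul_def, Algebra.smul_def, map_add, ← etaleRoot_mul_self, map_one, map_ofNat]
    ring
  rw [one_pow, mul_one] at h1
  rw [h3, map_add, map_smul, map_smul, h1, smul_zero, zero_add, smul_eq_mul, mul_eq_zero,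
    or_iff_right (Invertible.ne_zero (2 : F))] at h2
  obtain ⟨p, q, rfl⟩ := exists_eq_add_mul_etaleRoot d a
  have h4 := congrArg (algebraMap F (QuadraticEtale d)) h1
  have h5 := congrArg (algebraMap F (QuadraticEtale d)) h2
  rw [algebraMap_trace_quadraticEtale, map_zero] at h4 h5
  rw [map_mul, etaleConj_etaleRoot] at h5
  rw [etaleConj_add_mul] at h4 h5
  have h6 : algebraMap F (QuadraticEtale d) (2 * p) = 0 := by
    rw [← h4, map_mul, map_ofNat]; ring
  have h7 : algebraMap F (QuadraticEtale d) (2 * (q * d)) = 0 := by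
    rw [← h5, map_mul, map_mul, map_ofNat, ← etaleRoot_mul_self]; ring
  rw [map_eq_zero, mul_eq_zero, or_iff_right (Invertible.ne_zero (2 : F))] at h6 h7
  rw [mul_eq_zero, or_iff_left d.ne_zero] at h7
  rw [h6, h7] at ha
  simp at ha

variable {V : Type*} [AddCommGroup V] [Module (QuadraticEtale d) V] [Module F V]
    [IsScalarTower F (QuadraticEtale d) V]

variable {d}

omit [Invertible (2 : F)] in
theorem transfer_apply (ψ : QuadraticForm (QuadraticEtale d) V) (v : V) :
    transfer ψ v = Algebra.trace F (QuadraticEtale d) (ψ v) := rfl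

omit [Invertible (2 : F)] in
theorem polar_transfer (ψ : QuadraticForm (QuadraticEtale d) V) (v w : V) :
    QuadraticMap.polar (transfer ψ) v w =
      Algebra.trace F (QuadraticEtale d) (QuadraticMap.polar ψ v w) := by
  simp only [QuadraticMap.polar, transfer_apply, map_sub]

omit [Invertible (2 : F)] in
theorem finrank_eq_two_mul [Module.Free (QuadraticEtale d) V] :
    Module.finrank F V = 2 * Module.finrank (QuadraticEtale d) V := by
  rw [← Module.finrank_mul_finrank F (QuadraticEtale d) V, finrank_quadraticEtale]

/-- For a summand ⟨a⟩ choose c with q = tr(ac²) ≠ 0. Then c and δι(ac) are orthogonal for the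
transfer, because their polar value is 2N(ac)·tr(δ) = 0, and they have the values q and d·N(a)·q.
The product of all values is a square, as the rank is even and ∏ a is a square. -/
theorem nonempty_cliffordOrientation_transfer [Module.Free (QuadraticEtale d) V]
    [Module.Finite (QuadraticEtale d) V]
    (ψ : QuadraticForm (QuadraticEtale d) V) (h4 : 4 ∣ Module.finrank (QuadraticEtale d) V)
    (b : Module.Basis (Fin (Module.finrank (QuadraticEtale d) V)) (QuadraticEtale d) V)
    (w : (QuadraticEtale d)ˣ) (hb : ∀ i j, i ≠ j → QuadraticMap.polar ψ (b i) (b j) = 0)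
    (hw : ∏ i, ψ (b i) = (w : QuadraticEtale d) ^ 2) :
    Nonempty (CliffordOrientation (transfer ψ)) := by
  have hu : ∀ i, IsUnit (ψ (b i)) := fun i =>
    isUnit_of_dvd_unit (Finset.dvd_prod_of_mem (fun i => ψ (b i)) (Finset.mem_univ i)) (hw ▸ w.isUnit.pow 2)
  choose c hc using fun i => exists_trace_mul_sq_ne_zero d (hu i).ne_zero
  let δ : QuadraticEtale d := etaleRoot d
  let s : Fin (Module.finrank (QuadraticEtale d) V) → Fin 2 → QuadraticEtale d :=
    fun i => ![c i, δ * etaleConj d (ψ (b i) * c i)]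
  let f : Fin (Module.finrank (QuadraticEtale d) V) × Fin 2 → V := fun i => s i.1 i.2 • b i.1
  let q := fun i => Algebra.trace F (QuadraticEtale d) (ψ (b i) * c i ^ 2)
  have hf0 : ∀ i, transfer ψ (f (i, 0)) = q i := fun i => by
    change Algebra.trace F (QuadraticEtale d) (ψ (c i • b i)) = _
    rw [QuadraticMap.map_smul, smul_eq_mul, mul_comm, ← sq]
  have hf1 : ∀ i, transfer ψ (f (i, 1)) = d * Algebra.norm F (ψ (b i)) * q i := fun i => by
    change Algebra.trace F (QuadraticEtale d) (ψ ((δ * etaleConj d (ψ (b i) * c i)) • b i)) = _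
    have : ψ ((δ * etaleConj d (ψ (b i) * c i)) • b i) =
        (d * Algebra.norm F (ψ (b i))) • etaleConj d (ψ (b i) * c i ^ 2) := by
      rw [QuadraticMap.map_smul, smul_eq_mul, Algebra.smul_def, map_mul (algebraMap _ _),
        algebraMap_norm_quadraticEtale, ← etaleRoot_mul_self, map_mul, map_mul, map_pow]
      ring
    rw [this, map_smul, trace_etaleConj, smul_eq_mul]
  have hne : ∀ i, transfer ψ (f i) ≠ 0 := by
    rintro ⟨i, j⟩
    fin_cases j
    · exact (hf0 i).trans_ne (hc i)
    · refine (hf1 i).trans_ne (mul_ne_zero (mul_ne_zero d.ne_zero ?_) (hc i))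
      exact ((hu i).map (Algebra.norm F)).ne_zero
  have hz : ∀ i, Algebra.trace F (QuadraticEtale d)
      (QuadraticMap.polar ψ (s i 0 • b i) (s i 1 • b i)) = 0 := fun i => by
    have : QuadraticMap.polar ψ (s i 0 • b i) (s i 1 • b i) =
        (2 * Algebra.norm F (ψ (b i) * c i)) • (etaleRoot d : QuadraticEtale d) := by
      rw [QuadraticMap.polar_smul_left, QuadraticMap.polar_smul_right, QuadraticMap.polar_self,
        Algebra.smul_def (2 * _), map_mul (algebraMap _ _), algebraMap_norm_quadraticEtale,
        map_ofNat, nsmul_eq_mul, smul_eq_mul, smul_eq_mul]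
      change c i * (δ * etaleConj d (ψ (b i) * c i) * (2 * ψ (b i))) =
        2 * (ψ (b i) * c i * etaleConj d (ψ (b i) * c i)) * δ
      ring
    rw [this, map_smul, trace_etaleRoot, smul_zero]
  have hpol : ∀ i j, i ≠ j → QuadraticMap.polar (transfer ψ) (f i) (f j) = 0 := by
    rintro ⟨i, i'⟩ ⟨j, j'⟩ hij
    rw [polar_transfer]
    by_cases h : i = j
    · subst h
      have hij' : i' ≠ j' := fun h => hij (by rw [h])
      fin_cases i' <;> fin_cases j'
      · exact absurd rfl hij'
      · exact hz i
      · rw [QuadraticMap.polar_comm]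
        exact hz i
      · exact absurd rfl hij'
    · rw [QuadraticMap.polar_smul_left, QuadraticMap.polar_smul_right, hb i j h, smul_zero,
        smul_zero, map_zero]
  have hli : LinearIndependent F f := by
    refine LinearMap.linearIndependent_of_isOrthoᵢ (B := (transfer ψ).polarBilin)
      (fun i j hij => hpol i j hij) fun i h => hne i ?_
    have h' : QuadraticMap.polar (transfer ψ) (f i) (f i) = 0 := h
    rw [QuadraticMap.polar_self, nsmul_eq_mul, mul_eq_zero] at h'
    exact h'.resolve_left (by exact_mod_cast Invertible.ne_zero (2 : F))
  have hcard : Fintype.card (Fin (Module.finrank (QuadraticEtale d) V) × Fin 2) =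
      Module.finrank F V := by
    rw [Fintype.card_prod, Fintype.card_fin, Fintype.card_fin, finrank_eq_two_mul (d := d),
      mul_comm]
  obtain ⟨k, hk⟩ := h4
  have : Module.Finite F V := .trans (QuadraticEtale d) V
  let e := Fintype.equivFinOfCardEq hcard
  have hN : ∏ i, Algebra.norm F (ψ (b i)) = Algebra.norm F (w : QuadraticEtale d) ^ 2 := by
    rw [← map_prod, hw, map_pow]
  have hq : ∏ i, q i ≠ 0 := Finset.prod_ne_zero_iff.mpr fun i _ => hc i
  refine CliffordOrientation.nonempty_of_basis (by rw [finrank_eq_two_mul (d := d), hk]; omega)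
    ((basisOfLinearIndependentOfCardEqFinrank' f hli hcard).reindex e) (fun i j hij => ?_)
    -- With rank 4k over L, the product of the values is (∏ q)²·d^(4k)·N(w)².
    (Units.mk0 _ hq * d ^ (2 * k) * Units.map (Algebra.norm F) w) ?_
  · rw [Module.Basis.reindex_apply, Module.Basis.reindex_apply,
      coe_basisOfLinearIndependentOfCardEqFinrank']
    exact hpol _ _ (e.symm.injective.ne hij)
  · simp only [Module.Basis.reindex_apply, coe_basisOfLinearIndependentOfCardEqFinrank']
    rw [Equiv.prod_comp e.symm fun p => transfer ψ (f p), Fintype.prod_prod_type]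
    simp only [Fin.prod_univ_two, hf0, hf1, Finset.prod_mul_distrib, hN, Finset.prod_const,
      Finset.card_univ, Fintype.card_fin, Units.val_mul, Units.val_mk0, Units.val_pow_eq_pow_val,
      Units.coe_map]
    have hd : (d : F) ^ Module.finrank (QuadraticEtale d) V = (d ^ (2 * k)) ^ 2 := by
      rw [hk, ← pow_mul]
      congr 1
      ring
    rw [hd]
    ring

end QuadraticEtale

end

/-! ### The theorem -/

set_option maxHeartbeats 800000 in
theorem mainTheorem3 {F : Type*} [Field F] [Invertible (2 : F)] (d : Fˣ)
    {V : Type*} [AddCommGroup V] [Module (QuadraticEtale d) V] [Module F V]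
    [IsScalarTower F (QuadraticEtale d) V]
    [Module.Free (QuadraticEtale d) V] [Module.Finite (QuadraticEtale d) V]
    (ψ : QuadraticForm (QuadraticEtale d) V)
    (hψ : (QuadraticMap.associated ψ).Nondegenerate)
    (hdim : Module.finrank (QuadraticEtale d) V ≡ 0 [MOD 4])
    (hdisc : HasTrivialDiscriminant ψ)
    (l : (QuadraticEtale d)ˣ) (hl : ∃ v : V, ψ v = l) :
    -- the even Clifford algebra of `ψ` has two isomorphic components
    Nonempty (CliffordOrientation ψ) ∧
    (∀ o : CliffordOrientation ψ,
      IsoWithInvolution (QuadraticEtale d) (evenInvolution ψ)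
        (o.componentInvolution.prodMap o.neg.componentInvolution) ∧
      IsoWithInvolution (QuadraticEtale d) o.componentInvolution o.neg.componentInvolution) ∧
    -- the even Clifford algebra of the transfer of `ψ` has two components
    Nonempty (CliffordOrientation (transfer ψ)) ∧
    (∀ p : CliffordOrientation (transfer ψ),
      IsoWithInvolution F (evenInvolution (transfer ψ))
        (p.componentInvolution.prodMap p.neg.componentInvolution)) ∧
    -- the description of both components
    ∀ (o : CliffordOrientation ψ) (p : CliffordOrientation (transfer ψ)),
      IsoWithInvolution F p.componentInvolution
        (tensorInvolution (adPfister (-d * Units.map (Algebra.norm F) l))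
          (normInvolution (etaleConj d) (etaleConj_etaleConj d) o.componentInvolution)) ∧
      IsoWithInvolution F p.neg.componentInvolution
        (tensorInvolution (adPfister (-d * Units.map (Algebra.norm F) l))
          (normInvolution (etaleConj d) (etaleConj_etaleConj d) o.componentInvolution)) := by
  have h4 : 4 ∣ Module.finrank (QuadraticEtale d) V := (Nat.modEq_zero_iff_dvd).mp hdim
  obtain ⟨v, hv⟩ := hl
  have hV : Module.finrank (QuadraticEtale d) V ≠ 0 := fun h0 => by
    have := (Module.finrank_eq_zero_iff_of_free (QuadraticEtale d) V).mp h0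
    rw [Subsingleton.elim v 0, QuadraticMap.map_zero] at hv
    exact l.ne_zero hv.symm
  have hVF : Module.finrank F V ≠ 0 := by
    rw [finrank_eq_two_mul (d := d)]
    exact mul_ne_zero two_ne_zero hV
  obtain ⟨b, w, hb, hw⟩ := hdisc.exists_basis
    (symmetricDiagonalizable_of_isReduced (QuadraticEtale d)) h4
  refine ⟨CliffordOrientation.nonempty_of_basis h4 b hb w hw,
    fun o => ⟨o.isoWithInvolution_prod, o.isoWithInvolution_neg v l hv⟩,
    nonempty_cliffordOrientation_transfer ψ h4 b w hb hw, fun p => p.isoWithInvolution_prod,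
    fun o p => ?_⟩
  have := o.nontrivial_tensor v l hv (etaleConj d) (etaleConj_etaleConj d)
  obtain ⟨us, hus⟩ := o.exists_conjAverage_component hV
  let D := o.similitudeData v l hv (etaleConj d) (etaleConj_etaleConj d) (etaleRoot d)
    (etaleConj_etaleRoot d)
  have hQ : ∀ v, algebraMap F (QuadraticEtale d) (transfer ψ v) = ψ v + etaleConj d (ψ v) :=
    fun v => algebraMap_trace_quadraticEtale d (ψ v)
  -- The vector `v` itself serves as `v₀`, so its image under the similitude is `v * v`, the unit
  -- `l`; this is the invertible value that `rangeAdjoin_eq_top` needs.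
  have hx : D.x v = (l : QuadraticEtale d) • 1 := by
    change o.toComponent (evenPair ψ v v) = _
    rw [evenPair_self, AlgHom.commutes, hv, Algebra.algebraMap_eq_smul_one]
  have hx' : o.componentInvolution (D.x v) = D.x v := o.componentInvolution_vectorMap v v
  have hu : IsUnit (D.x v) := by
    rw [hx, ← Algebra.algebraMap_eq_smul_one]
    exact l.isUnit.map _
  exact D.isoWithInvolution_components _ hQ p hVF (exists_eq_add_mul_etaleRoot d)
    (D.rangeAdjoin_eq_top _ hQ (o.adjoin_vectorMap_eq_top v l hv) v hu (by rw [hx']; exact hu)) d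
    (Units.map (Algebra.norm F) l) (etaleRoot_mul_self d).symm
    (algebraMap_norm_quadraticEtale d l) us hus
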